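/- Let $\mathbb{Q}_{\mathbb R}=\{\beta_1+\beta_2 j:\beta_1,\beta_2\in\mathbb C\}$ be the commutative algebra of reduced biquaternions, $j^2=1$. For a matrix $M=M_1+M_2j$ over $\mathbb{Q}_{\mathbb R}$ ($M_1,M_2$ complex) put $M_c=\begin{bmatrix}M_1\\M_2\end{bmatrix}$ and $\|M\|_F=(\|M_1\|_F^2+\|M_2\|_F^2)^{1/2}$. Let $A\in\mathbb{Q}_{\mathbb R}^{m\times n}$, $B\in\mathbb{Q}_{\mathbb R}^{m\times d}$, $C\in\mathbb{Q}_{\mathbb R}^{p\times n}$, $D\in\mathbb{Q}_{\mathbb R}^{p\times d}$ with $m\ge n+d$ and $C_c$ of full row rank $2p$. A matrix $X\in\mathbb C^{n\times d}$ is a complex RBTLSE solution for $(A,B,C,D)$ if it attains $$\min_{X,\bar G,\bar H}\|[\bar G,\bar H]\|_F\quad\text{subject to}\quad (A+\bar G)X=B+\bar H,\quad CX=D,$$ where $X$ ranges over complex and $\bar G,\bar H$ over reduced biquaternion matrices. Put $J=\begin{bmatrix}C\\A\end{bmatrix}$, $K=\begin{bmatrix}D\\B\end{bmatrix}$, $J_c=\begin{bmatrix}C_c\\A_c\end{bmatrix}$,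 $K_c=\begin{bmatrix}D_c\\B_c\end{bmatrix}$, $P=[A_c,B_c]$, $S=[C_c,D_c]$. Let $S^H=[Q_1,Q_2]\begin{bmatrix}R\\0\end{bmatrix}$ be a QR factorization ($[Q_1,Q_2]$ unitary of order $n+d$, $Q_1$ with $2p$ columns, $R$ upper triangular). Let $PQ_2=U\Sigma V^H$ be a thin SVD with singular values $\sigma_1\ge\dots\ge\sigma_{n-2p}>\sigma_{n-2p+1}\ge\dots\ge\sigma_{n-2p+d}>0$; write $U=[U_1,U_2]$, $\Sigma=\mathrm{diag}(\Sigma_1,\Sigma_2)$ and $$Q_2V=[\acute V_1,\acute V_2]=\begin{bmatrix}\acute V_{11}&\acute V_{12}\\ \acute V_{21}&\acute V_{22}\end{bmatrix},$$ with column blocks of sizes $n-2p$, $d$ and row blocks of sizes $n$, $d$. Assume that $\acute V_{22}$ is invertible. Let $S=U_sS_sV_s^H$ be a skinny SVD of $S$ and $S^\dagger$ its Moore-Penrose inverse, and put $$Q_c=\begin{bmatrix}-(PS^\dagger)^H\\ I_{2m}\end{bmatrix},\quad S_c=\begin{bmatrix}S_s&0\\0&\Sigma_1\end{bmatrix},\quad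 W_c=[V_s,\acute V_1]=\begin{bmatrix}W_{1c}\\W_{2c}\end{bmatrix},$$ with $W_{1c}$ of order $n$, and $\Pi_{(d,n)}=\sum_{i=1}^d\sum_{j=1}^nE_{ij}\otimes E_{ij}^T$, where $E_{ij}$ are the elementary matrices of size $d\times n$. Let $$H_c=(\acute V_{22}^{-T}\otimes W_{1c}^{-H})\,\Pi_{(d,n)},$$ $$G_c=\left(S_c^2\otimes I_d-\begin{bmatrix}0_{2p}&0\\0&I_{n-2p}\end{bmatrix}\otimes(\Sigma_2^H\Sigma_2)\right)^{-1}\left[I_n\otimes\Sigma_2^H,\ S_c\otimes I_d\right],$$ $$Z_c=\mathrm{diag}\left(\begin{bmatrix}0_{2p}&0\\0&I_{n-2p}\end{bmatrix}\otimes(U_2^TQ_c^T),\ \begin{bmatrix}I_{2p}&0\\-U_1^H(PS^\dagger)U_s&I_{n-2p}\end{bmatrix}\otimes I_d\right),$$ where $T$ is the plain transpose and $H$ the conjugate transpose. Let $X_{CT}$ be the complex RBTLSE solution for $(A,B,C,D)$, and suppose $X_{CT}\neq0$. Then for all sufficiently small perturbations $\Delta A,\Delta B,\Delta C,\Delta D$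 (with $\Delta J,\Delta K$ formed from them as $J,K$ are from $A,B,C,D$) the perturbed problem with data $A+\Delta A,\dots,D+\Delta D$ has exactly one complex RBTLSE solution $\widehat X_{CT}$, and with $\Delta X_{CT}=\widehat X_{CT}-X_{CT}$ the relative normwise condition number is $$\lim_{\epsilon\to0^+}\ \sup\left\{\frac{\|\Delta X_{CT}\|_F}{\epsilon\|X_{CT}\|_F}\ :\ \|[\Delta J,\Delta K]\|_F\le\epsilon\|[J,K]\|_F\right\}=\|H_cG_cZ_c\|_2\,\frac{\|[J_c,K_c]\|_F}{\|X_{CT}\|_F}.$$ -/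

import Mathlib

open Matrix Filter Topology
open scoped Kronecker ENNReal

noncomputable section

namespace RBTLSE

/-! ### Reduced biquaternions and their matrices -/

/-- The commutative algebra of reduced biquaternions: `z = z.re + z.im * j` with complex
coefficients `z.re`, `z.im` and `j ^ 2 = 1`.  With `i` the imaginary unit of `ℂ` and `k = i * j`
this gives `i ^ 2 = k ^ 2 = -1`, `i * j = j * i = k`, `j * k = k * j = i`,
`k * i = i * k = -j`. -/
abbrev RB : Type := QuadraticAlgebra ℂ 1 0

/-- The multiplication rule of the reduced biquaternions in the form `β₁ + β₂ j`. -/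
theorem rb_mul (z w : RB) :
    z * w = ⟨z.re * w.re + z.im * w.im, z.re * w.im + z.im * w.re⟩ := by
  ext <;> simp

/-- Frobenius norm of a reduced biquaternion matrix; the squared norm of an entry `β₁ + β₂ j`
is `|β₁|² + |β₂|²`. -/
def rbFrob {α β : Type*} [Fintype α] [Fintype β] (M : Matrix α β RB) : ℝ :=
  √(∑ i, ∑ j, (‖(M i j).re‖ ^ 2 + ‖(M i j).im‖ ^ 2))

/-- A complex matrix, viewed as a reduced biquaternion matrix. -/
def ofComplex {α β : Type*} (X : Matrix α β ℂ) : Matrix α β RB :=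
  X.map (algebraMap ℂ RB)

/-- First block column `[R₁; R₂]` of the complex representation `[R₁ R₂; R₂ R₁]` of
`R₁ + R₂ j`. -/
def cCol {α β : Type*} (M : Matrix α β RB) : Matrix (α ⊕ α) β ℂ :=
  fromRows (M.map QuadraticAlgebra.re) (M.map QuadraticAlgebra.im)

/-! ### Matrix norms -/

open scoped Matrix.Norms.Frobenius in
/-- Frobenius norm of a complex matrix. -/
def frobNorm {α β : Type*} [Fintype α] [Fintype β] (M : Matrix α β ℂ) : ℝ := ‖M‖

open scoped Matrix.Norms.L2Operator in
/-- Spectral norm (Euclidean operator norm) of a complex matrix. -/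
def specNorm {α β : Type*} [Fintype α] [Fintype β] [DecidableEq β] (M : Matrix α β ℂ) : ℝ := ‖M‖

/-! ### The equality-constrained total least squares problem -/

section Problem

variable {m n d p : ℕ}

/-- Feasibility: `(A + G) X = B + H` and `C X = D`, with `X` complex. -/
def IsFeasible (A : Matrix (Fin m) (Fin n) RB) (B : Matrix (Fin m) (Fin d) RB)
    (C : Matrix (Fin p) (Fin n) RB) (D : Matrix (Fin p) (Fin d) RB)
    (X : Matrix (Fin n) (Fin d) ℂ)
    (G : Matrix (Fin m) (Fin n) RB) (H : Matrix (Fin m) (Fin d) RB) : Prop :=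
  (A + G) * ofComplex X = B + H ∧ C * ofComplex X = D

/-- `X` is a complex RBTLSE solution: it is feasible with some `G`, `H` for which
`‖[G, H]‖_F` is minimal among all feasible triples. -/
def IsComplexSolution (A : Matrix (Fin m) (Fin n) RB) (B : Matrix (Fin m) (Fin d) RB)
    (C : Matrix (Fin p) (Fin n) RB) (D : Matrix (Fin p) (Fin d) RB)
    (X : Matrix (Fin n) (Fin d) ℂ) : Prop :=
  ∃ (G : Matrix (Fin m) (Fin n) RB) (H : Matrix (Fin m) (Fin d) RB),
    IsFeasible A B C D X G H ∧
    ∀ (X' : Matrix (Fin n) (Fin d) ℂ) (G' : Matrix (Fin m) (Fin n) RB)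
      (H' : Matrix (Fin m) (Fin d) RB), IsFeasible A B C D X' G' H' →
        rbFrob (fromCols G H) ≤ rbFrob (fromCols G' H')

/-- The block matrix `[J, K]` with `J = [C; A]` and `K = [D; B]`. -/
def dataJK (A : Matrix (Fin m) (Fin n) RB) (B : Matrix (Fin m) (Fin d) RB)
    (C : Matrix (Fin p) (Fin n) RB) (D : Matrix (Fin p) (Fin d) RB) :
    Matrix (Fin p ⊕ Fin m) (Fin n ⊕ Fin d) RB :=
  fromCols (fromRows C A) (fromRows D B)

/-- The block matrix `[J_c, K_c]` with `J_c = [C_c; A_c]` and `K_c = [D_c; B_c]`, where the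
subscript denotes the first block column of the complex representation. -/
def dataJKc (A : Matrix (Fin m) (Fin n) RB) (B : Matrix (Fin m) (Fin d) RB)
    (C : Matrix (Fin p) (Fin n) RB) (D : Matrix (Fin p) (Fin d) RB) :
    Matrix ((Fin p ⊕ Fin p) ⊕ (Fin m ⊕ Fin m)) (Fin n ⊕ Fin d) ℂ :=
  fromCols (fromRows (cCol C) (cCol A)) (fromRows (cCol D) (cCol B))

/-- Supremum of `‖X̂ - X‖_F / (ε ‖X‖_F)` over all perturbations with
`‖[ΔJ, ΔK]‖_F ≤ ε ‖[J, K]‖_F`, where `X̂` is the complex solution of the perturbed problem.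
The supremum is taken in `[0, ∞]`, so that no boundedness is presupposed. -/
def relChangeSup (A : Matrix (Fin m) (Fin n) RB) (B : Matrix (Fin m) (Fin d) RB)
    (C : Matrix (Fin p) (Fin n) RB) (D : Matrix (Fin p) (Fin d) RB)
    (X : Matrix (Fin n) (Fin d) ℂ) (ε : ℝ) : ℝ≥0∞ :=
  sSup {r | ∃ (ΔA : Matrix (Fin m) (Fin n) RB) (ΔB : Matrix (Fin m) (Fin d) RB)
      (ΔC : Matrix (Fin p) (Fin n) RB) (ΔD : Matrix (Fin p) (Fin d) RB)
      (X' : Matrix (Fin n) (Fin d) ℂ),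
      rbFrob (dataJK ΔA ΔB ΔC ΔD) ≤ ε * rbFrob (dataJK A B C D) ∧
      IsComplexSolution (A + ΔA) (B + ΔB) (C + ΔC) (D + ΔD) X' ∧
      r = ENNReal.ofReal (frobNorm (X' - X) / (ε * frobNorm X))}

/-- All problems obtained by sufficiently small perturbations of the data have exactly one
complex solution. -/
def IsLocallyUniquelySolvable (A : Matrix (Fin m) (Fin n) RB) (B : Matrix (Fin m) (Fin d) RB)
    (C : Matrix (Fin p) (Fin n) RB) (D : Matrix (Fin p) (Fin d) RB) : Prop :=
  ∃ δ : ℝ, 0 < δ ∧ ∀ (ΔA : Matrix (Fin m) (Fin n) RB) (ΔB : Matrix (Fin m) (Fin d) RB)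
    (ΔC : Matrix (Fin p) (Fin n) RB) (ΔD : Matrix (Fin p) (Fin d) RB),
    rbFrob (dataJK ΔA ΔB ΔC ΔD) ≤ δ →
      ∃! X' : Matrix (Fin n) (Fin d) ℂ,
        IsComplexSolution (A + ΔA) (B + ΔB) (C + ΔC) (D + ΔD) X'

/-- The relative normwise condition number of the complex solution `X` (well defined because
small perturbations of the data are uniquely solvable) equals `κ`. -/
def HasRelConditionNumber (A : Matrix (Fin m) (Fin n) RB) (B : Matrix (Fin m) (Fin d) RB)
    (C : Matrix (Fin p) (Fin n) RB) (D : Matrix (Fin p) (Fin d) RB)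
    (X : Matrix (Fin n) (Fin d) ℂ) (κ : ℝ) : Prop :=
  IsLocallyUniquelySolvable A B C D ∧
    Tendsto (relChangeSup A B C D X) (𝓝[>] 0) (𝓝 (ENNReal.ofReal κ))

end Problem

/-! ### Factorizations -/

/-- The real diagonal matrix `diag(s)` with complex entries. -/
def rdiag {α : Type*} [DecidableEq α] (s : α → ℝ) : Matrix α α ℂ :=
  diagonal fun i => (s i : ℂ)

/-- Full QR factorization `Sᴴ = [Q₁, Q₂] [R; 0]` with `[Q₁, Q₂]` unitary and `R` upper
triangular. -/
structure IsFullQR {p : ℕ} {α β : Type*} [Fintype α] [DecidableEq α] [Fintype β] [DecidableEq β]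
    (S : Matrix (Fin p ⊕ Fin p) α ℂ) (Q₁ : Matrix α (Fin p ⊕ Fin p) ℂ) (Q₂ : Matrix α β ℂ)
    (R : Matrix (Fin p ⊕ Fin p) (Fin p ⊕ Fin p) ℂ) : Prop where
  left_unitary : (fromCols Q₁ Q₂)ᴴ * fromCols Q₁ Q₂ = 1
  right_unitary : fromCols Q₁ Q₂ * (fromCols Q₁ Q₂)ᴴ = 1
  upper : R.BlockTriangular (finSumFinEquiv : Fin p ⊕ Fin p ≃ Fin (p + p))
  factor : Sᴴ = fromCols Q₁ Q₂ * fromRows R (0 : Matrix β (Fin p ⊕ Fin p) ℂ)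

/-- Singular value decomposition `M = U diag(s) Vᴴ` in which `U` and `V` have orthonormal columns
and all the (listed) singular values `s` are positive. -/
structure IsThinSVD {α β γ : Type*} [Fintype α] [Fintype β] [Fintype γ] [DecidableEq γ]
    (M : Matrix α β ℂ) (U : Matrix α γ ℂ) (s : γ → ℝ) (V : Matrix β γ ℂ) : Prop where
  left_orthonormal : Uᴴ * U = 1
  right_orthonormal : Vᴴ * V = 1
  pos : ∀ i, 0 < s i
  factor : M = U * rdiag s * Vᴴ

/-- `T` is the Moore-Penrose inverse of `S`. -/
structure IsMoorePenrose {α β : Type*} [Fintype α] [Fintype β]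
    (S : Matrix α β ℂ) (T : Matrix β α ℂ) : Prop where
  mul_mul_self : S * T * S = S
  self_mul_mul : T * S * T = T
  left_hermitian : (S * T)ᴴ = S * T
  right_hermitian : (T * S)ᴴ = T * S

/-! ### The matrices in the formula for the condition number -/

/-- Index set of size `2 p + q`, split into blocks of sizes `p`, `p`, `q`. -/
abbrev Idx (p q : ℕ) : Type := (Fin p ⊕ Fin p) ⊕ Fin q

/-- Concatenation of the blocks, for `n = 2 p + q`. -/
def idxEquiv {n p q : ℕ} (h : n = 2 * p + q) : Idx p q ≃ Fin n :=
  ((finSumFinEquiv.sumCongr (Equiv.refl (Fin q))).trans finSumFinEquiv).trans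
    (finCongr (by omega))

/-- Inverse of a square matrix whose rows and columns are indexed by different types, identified
by `e` (the result does not depend on `e`). -/
def sqInv {α β : Type*} [Fintype α] [DecidableEq α] (e : β ≃ α) (M : Matrix α β ℂ) :
    Matrix β α ℂ :=
  (M.submatrix id e.symm)⁻¹.submatrix e id

/-- The permutation matrix `Π = ∑ i j, E i j ⊗ (E i j)ᵀ` with `E i j` the elementary matrices of
size `α × β`. -/
def permPi (α β : Type*) [Fintype α] [DecidableEq α] [Fintype β] [DecidableEq β] :
    Matrix (α × β) (β × α) ℂ :=
  ∑ i : α, ∑ j : β, (single i j (1 : ℂ)) ⊗ₖ (single i j (1 : ℂ))ᵀ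

section Formula

variable {m n d p q : ℕ}

/-- `Q_c = [-(P S†)ᴴ; I]`, as a function of `T = P S†`. -/
def Qc (T : Matrix (Fin m ⊕ Fin m) (Fin p ⊕ Fin p) ℂ) :
    Matrix ((Fin p ⊕ Fin p) ⊕ (Fin m ⊕ Fin m)) (Fin m ⊕ Fin m) ℂ :=
  fromRows (-Tᴴ) 1

/-- `S_c = diag(S_s, Σ₁)`. -/
def Sc (s : Fin p ⊕ Fin p → ℝ) (σ₁ : Fin q → ℝ) : Matrix (Idx p q) (Idx p q) ℂ :=
  fromBlocks (rdiag s) 0 0 (rdiag σ₁)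

/-- `W₁`, the first `n` rows of `[V_s, V₁]`. -/
def W1c (Vs : Matrix (Fin n ⊕ Fin d) (Fin p ⊕ Fin p) ℂ) (V₁ : Matrix (Fin n ⊕ Fin d) (Fin q) ℂ) :
    Matrix (Fin n) (Idx p q) ℂ :=
  (fromCols Vs V₁).toRows₁

/-- `diag(0_{2p}, I_q)`. -/
def tailProj (p q : ℕ) : Matrix (Idx p q) (Idx p q) ℂ := fromBlocks 0 0 0 1

/-- `H_c = (V₂₂⁻ᵀ ⊗ W₁⁻ᴴ) Π`. -/
def Hc (h : n = 2 * p + q) (V22 : Matrix (Fin d) (Fin d) ℂ) (W₁ : Matrix (Fin n) (Idx p q) ℂ) :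
    Matrix (Fin d × Fin n) (Idx p q × Fin d) ℂ :=
  ((V22⁻¹)ᵀ ⊗ₖ (sqInv (idxEquiv h) W₁)ᴴ) * permPi (Fin d) (Idx p q)

/-- `G_c = (S_c² ⊗ I_d - diag(0, I) ⊗ Σ₂ᴴ Σ₂)⁻¹ [I_n ⊗ Σ₂ᴴ, S_c ⊗ I_d]`. -/
def Gc (S : Matrix (Idx p q) (Idx p q) ℂ) (Sg₂ : Matrix (Fin d) (Fin d) ℂ) :
    Matrix (Idx p q × Fin d) ((Idx p q × Fin d) ⊕ (Idx p q × Fin d)) ℂ :=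
  ((S ^ 2) ⊗ₖ (1 : Matrix (Fin d) (Fin d) ℂ) - tailProj p q ⊗ₖ (Sg₂ᴴ * Sg₂))⁻¹ *
    fromCols ((1 : Matrix (Idx p q) (Idx p q) ℂ) ⊗ₖ Sg₂ᴴ) (S ⊗ₖ (1 : Matrix (Fin d) (Fin d) ℂ))

/-- `Z_c = diag(diag(0, I) ⊗ U₂ᵀ Q_cᵀ, [I, 0; -U₁ᴴ (P S†) U_s, I] ⊗ I_d)`, with `T = P S†`. -/
def Zc (T : Matrix (Fin m ⊕ Fin m) (Fin p ⊕ Fin p) ℂ)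
    (Us : Matrix (Fin p ⊕ Fin p) (Fin p ⊕ Fin p) ℂ)
    (U₁ : Matrix (Fin m ⊕ Fin m) (Fin q) ℂ) (U₂ : Matrix (Fin m ⊕ Fin m) (Fin d) ℂ) :
    Matrix ((Idx p q × Fin d) ⊕ (Idx p q × Fin d))
      ((Idx p q × ((Fin p ⊕ Fin p) ⊕ (Fin m ⊕ Fin m))) ⊕ (Idx p q × Fin d)) ℂ :=
  fromBlocks
    (tailProj p q ⊗ₖ (U₂ᵀ * (Qc T)ᵀ)) 0
    0 ((fromBlocks 1 0 (-(U₁ᴴ * T * Us)) 1 : Matrix (Idx p q) (Idx p q) ℂ) ⊗ₖ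
        (1 : Matrix (Fin d) (Fin d) ℂ))

end Formula

end RBTLSE

end

open RBTLSE

/-! The first block column identifies reduced biquaternion matrices isometrically with stacked
complex ones, so the problem is the complex equality-constrained total least squares problem for
`S = [C_c, D_c]` and `P = [A_c, B_c]`. Write `Y = [X; -1]`. At a solution the constraint `S Y = 0`
and the stationarity equation `Pᴴ P Y = Sᴴ Λ + Y M` hold. Conversely, if on the kernel of `S` the
form `‖P y‖² / ‖y‖²` is larger on the complement of the span of `Y` than on that span, then a Ky
Fan type minimum principle makes `X` the unique solution; this gap is stable under perturbation.
The gap also makes the linearization of the two equations invertible, so by the implicit function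
theorem the solution is a differentiable function of the data. The condition number is then the
operator norm of its derivative, rescaled.

In the coordinates given by the singular vectors the linearized equations are diagonal. Split a
data perturbation `Δ = [ΔS; ΔP]` into its orthogonal components `Δ W` and `Δ V₂`, where `W` and `V₂`
together form a unitary matrix: the derivative depends on the adjoint of the former and on a
projection of the latter, whose coordinates are independent, and `G_c Z_c` is its matrix in these
coordinates. `H_c` changes the coordinates of the result back. -/

noncomputable section

namespace RBTLSE

section SpecNorm

open scoped Matrix.Norms.L2Operator

variable {α β : Type*} [Fintype α] [Fintype β] [DecidableEq β]

theorem norm_mulVec_le_specNorm (M : Matrix α β ℂ) (v : β → ℂ) :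
    ‖WithLp.toLp 2 (M *ᵥ v)‖ ≤ specNorm M * ‖WithLp.toLp 2 v‖ :=
  l2_opNorm_mulVec M (WithLp.toLp 2 v)

theorem specNorm_le {M : Matrix α β ℂ} {c : ℝ} (hc : 0 ≤ c)
    (h : ∀ v : β → ℂ, ‖WithLp.toLp 2 (M *ᵥ v)‖ ≤ c * ‖WithLp.toLp 2 v‖) : specNorm M ≤ c := by
  rw [specNorm, l2_opNorm_def]
  exact ContinuousLinearMap.opNorm_le_bound _ hc fun v => h v.ofLp

theorem isLeast_specNorm {E F : Type*} [Norm E] [Norm F] {L : E → F} {M : Matrix α β ℂ}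
    {c : E → β → ℂ} (hM : ∀ x, ‖WithLp.toLp 2 (M *ᵥ c x)‖ = ‖L x‖)
    (hc : ∀ x, ‖WithLp.toLp 2 (c x)‖ ≤ ‖x‖)
    (hsurj : ∀ v, ∃ x, c x = v ∧ ‖x‖ = ‖WithLp.toLp 2 v‖) :
    IsLeast {b | 0 ≤ b ∧ ∀ x, ‖L x‖ ≤ b * ‖x‖} (specNorm M) := by
  have hM₀ : 0 ≤ specNorm M := norm_nonneg M
  refine ⟨⟨hM₀, fun x => ?_⟩, fun b hb => specNorm_le hb.1 fun v => ?_⟩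
  · rw [← hM]
    exact (norm_mulVec_le_specNorm M _).trans (mul_le_mul_of_nonneg_left (hc x) hM₀)
  · obtain ⟨x, rfl, hx⟩ := hsurj v
    rw [hM, ← hx]
    exact hb.2 x

end SpecNorm

open scoped Matrix.Norms.Frobenius

/-! ### The Frobenius norm and orthonormal columns -/

section Frobenius

variable {α β γ : Type*} [Fintype α] [Fintype β] [Fintype γ]

theorem frobenius_norm_sq (A : Matrix α β ℂ) : ‖A‖ ^ 2 = ∑ i, ∑ j, ‖A i j‖ ^ 2 := by
  rw [frobenius_norm_def, ← Real.sqrt_eq_rpow, Real.sq_sqrt (by positivity)]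
  simp only [Real.rpow_two]

theorem frobenius_norm_sq_eq_trace (A : Matrix α β ℂ) : ‖A‖ ^ 2 = (trace (Aᴴ * A)).re := by
  rw [frobenius_norm_sq, Finset.sum_comm]
  simp only [trace, diag_apply, mul_apply, conjTranspose_apply, Complex.re_sum]
  refine Finset.sum_congr rfl fun i _ => Finset.sum_congr rfl fun j _ => ?_
  rw [Complex.star_def, ← Complex.normSq_eq_conj_mul_self, Complex.ofReal_re,
    Complex.normSq_eq_norm_sq]

theorem frobenius_norm_add_sq {A B : Matrix α β ℂ} (h : Aᴴ * B = 0) :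
    ‖A + B‖ ^ 2 = ‖A‖ ^ 2 + ‖B‖ ^ 2 := by
  have h' : Bᴴ * A = 0 := by simpa using congrArg conjTranspose h
  simp only [frobenius_norm_sq_eq_trace, conjTranspose_add, Matrix.add_mul, Matrix.mul_add, h, h',
    add_zero, zero_add, trace_add, Complex.add_re]

variable [DecidableEq β] {Q : Matrix α β ℂ}

theorem frobenius_norm_mul_of_orthonormal (hQ : Qᴴ * Q = 1) (A : Matrix β γ ℂ) :
    ‖Q * A‖ = ‖A‖ := by
  rw [← sq_eq_sq₀ (norm_nonneg _) (norm_nonneg _), frobenius_norm_sq_eq_trace,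
    frobenius_norm_sq_eq_trace, conjTranspose_mul, Matrix.mul_assoc, ← Matrix.mul_assoc Qᴴ, hQ,
    Matrix.one_mul]

theorem frobenius_norm_mul_conjTranspose_of_orthonormal (hQ : Qᴴ * Q = 1) (A : Matrix γ β ℂ) :
    ‖A * Qᴴ‖ = ‖A‖ := by
  rw [← frobenius_norm_conjTranspose, conjTranspose_mul, conjTranspose_conjTranspose,
    frobenius_norm_mul_of_orthonormal hQ, frobenius_norm_conjTranspose]

theorem frobenius_norm_sq_eq_add_of_orthonormal (hQ : Qᴴ * Q = 1) (A : Matrix α γ ℂ) :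
    ‖A‖ ^ 2 = ‖Qᴴ * A‖ ^ 2 + ‖A - Q * (Qᴴ * A)‖ ^ 2 := by
  have horth : (Q * (Qᴴ * A))ᴴ * (A - Q * (Qᴴ * A)) = 0 := by
    rw [conjTranspose_mul, Matrix.mul_assoc, Matrix.mul_sub, ← Matrix.mul_assoc Qᴴ Q, hQ,
      Matrix.one_mul, sub_self, Matrix.mul_zero]
  rw [← frobenius_norm_mul_of_orthonormal hQ (Qᴴ * A), ← frobenius_norm_add_sq horth,
    add_sub_cancel]

theorem frobenius_norm_sq_eq_add_of_orthonormal' (hQ : Qᴴ * Q = 1) (A : Matrix γ α ℂ) :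
    ‖A‖ ^ 2 = ‖A * Q‖ ^ 2 + ‖A - A * Q * Qᴴ‖ ^ 2 := by
  have h := frobenius_norm_sq_eq_add_of_orthonormal hQ Aᴴ
  rwa [← frobenius_norm_conjTranspose (Qᴴ * Aᴴ), ← frobenius_norm_conjTranspose (Aᴴ - _),
    frobenius_norm_conjTranspose A, conjTranspose_sub, conjTranspose_mul Q, conjTranspose_mul Qᴴ,
    conjTranspose_conjTranspose, conjTranspose_conjTranspose] at h

theorem frobenius_norm_conjTranspose_mul_le_of_orthonormal (hQ : Qᴴ * Q = 1)
    (A : Matrix α γ ℂ) : ‖Qᴴ * A‖ ≤ ‖A‖ := by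
  refine le_of_sq_le_sq ?_ (norm_nonneg _)
  rw [frobenius_norm_sq_eq_add_of_orthonormal hQ A]
  exact le_add_of_nonneg_right (sq_nonneg _)

theorem frobenius_norm_mul_le_of_orthonormal (hQ : Qᴴ * Q = 1) (A : Matrix γ α ℂ) :
    ‖A * Q‖ ≤ ‖A‖ := by
  refine le_of_sq_le_sq ?_ (norm_nonneg _)
  rw [frobenius_norm_sq_eq_add_of_orthonormal' hQ A]
  exact le_add_of_nonneg_right (sq_nonneg _)

open scoped ComplexOrder MatrixOrder in
theorem exists_orthonormal_mul_of_leftInverse {Y : Matrix α β ℂ} {L : Matrix β α ℂ}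
    (hL : L * Y = 1) : ∃ T : Matrix β β ℂ, IsUnit T.det ∧ (Y * T)ᴴ * (Y * T) = 1 := by
  have hinj : Function.Injective Y.mulVec := fun x y h => by
    simpa [mulVec_mulVec, hL] using congrArg L.mulVec h
  have hgram : IsUnit (Yᴴ * Y) := (PosDef.conjTranspose_mul_self Y hinj).isUnit
  obtain ⟨B, hB⟩ := CStarAlgebra.nonneg_iff_eq_star_mul_self.mp
    (posSemidef_conjTranspose_mul_self Y).nonneg
  have hBu : IsUnit B.det := by
    rw [hB, isUnit_iff_isUnit_det, det_mul] at hgram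
    exact isUnit_of_mul_isUnit_right hgram
  refine ⟨B⁻¹, isUnit_nonsing_inv_det _ hBu, ?_⟩
  calc (Y * B⁻¹)ᴴ * (Y * B⁻¹) = (B⁻¹)ᴴ * (Yᴴ * Y) * B⁻¹ := by
        simp only [conjTranspose_mul, Matrix.mul_assoc]
    _ = (B * B⁻¹)ᴴ * (B * B⁻¹) := by
        simp only [hB, star_eq_conjTranspose, conjTranspose_mul, Matrix.mul_assoc]
    _ = 1 := by rw [mul_nonsing_inv _ hBu, conjTranspose_one, Matrix.one_mul]

end Frobenius

/-! ### Minimality of stationary points -/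

section Minimality

variable {α β κ δ : Type*} [Fintype β] [Fintype κ] [Fintype δ]

/-- `‖P y‖² ≤ c ‖y‖²` on the column space of `Y`; since the Frobenius norm acts columnwise, the
bound may be tested on matrices. -/
def BoundedAboveOnRange (P : Matrix β κ ℂ) (Y : Matrix κ δ ℂ) (c : ℝ) : Prop :=
  ∀ x : Matrix δ κ ℂ, ‖P * (Y * x)‖ ^ 2 ≤ c * ‖Y * x‖ ^ 2

/-- `c ‖r‖² ≤ ‖P r‖²` on the part of the kernel of `S` that is orthogonal to the columns
of `Y`. -/
def BoundedBelowOnOrthogonal (S : Matrix α κ ℂ) (P : Matrix β κ ℂ) (Y : Matrix κ δ ℂ) (c : ℝ) :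
    Prop :=
  ∀ r : Matrix κ δ ℂ, S * r = 0 → Yᴴ * r = 0 → c * ‖r‖ ^ 2 ≤ ‖P * r‖ ^ 2

theorem BoundedAboveOnRange.mul_right {P : Matrix β κ ℂ} {Y : Matrix κ δ ℂ} {c : ℝ}
    (h : BoundedAboveOnRange P Y c) (T : Matrix δ δ ℂ) : BoundedAboveOnRange P (Y * T) c :=
  fun x => by simpa only [Matrix.mul_assoc] using h (T * x)

variable [DecidableEq δ]

theorem BoundedBelowOnOrthogonal.mul_right {S : Matrix α κ ℂ} {P : Matrix β κ ℂ}
    {Y : Matrix κ δ ℂ} {c : ℝ} (h : BoundedBelowOnOrthogonal S P Y c) {T : Matrix δ δ ℂ}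
    (hT : IsUnit T.det) : BoundedBelowOnOrthogonal S P (Y * T) c := fun r hSr hYr =>
  h r hSr <| calc
    Yᴴ * r = (Y * T * T⁻¹)ᴴ * r := by rw [Matrix.mul_assoc, mul_nonsing_inv _ hT, Matrix.mul_one]
    _ = 0 := by rw [conjTranspose_mul, Matrix.mul_assoc, hYr, Matrix.mul_zero]

/-- A Ky Fan type minimum principle. With `b = Yᴴ F` and the defects `R = F - Y b` and
`D = Yᴴ - b Fᴴ`, both `P F` and `P Y` split orthogonally, and `‖R‖ = ‖D‖`. -/
theorem norm_mul_sq_add_gap_le [Fintype α] {S : Matrix α κ ℂ} {P : Matrix β κ ℂ}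
    {Y F : Matrix κ δ ℂ} {Λ : Matrix α δ ℂ} {M : Matrix δ δ ℂ} {c c' : ℝ}
    (hY : Yᴴ * Y = 1) (hF : Fᴴ * F = 1) (hSY : S * Y = 0) (hSF : S * F = 0)
    (hP : Pᴴ * (P * Y) = Sᴴ * Λ + Y * M) (habove : BoundedAboveOnRange P Y c)
    (hbelow : BoundedBelowOnOrthogonal S P Y c') :
    ‖P * Y‖ ^ 2 + (c' - c) * ‖F - Y * (Yᴴ * F)‖ ^ 2 ≤ ‖P * F‖ ^ 2 := by
  set b := Yᴴ * F with hb
  set R := F - Y * b with hR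
  set D := Yᴴ - b * Fᴴ with hD
  have hYR : Yᴴ * R = 0 := by
    rw [hR, Matrix.mul_sub, ← Matrix.mul_assoc, hY, Matrix.one_mul, sub_self]
  have hSR : S * R = 0 := by
    rw [hR, Matrix.mul_sub, hSF, ← Matrix.mul_assoc, hSY, Matrix.zero_mul, sub_zero]
  have hPF : ‖P * F‖ ^ 2 = ‖P * (Y * b)‖ ^ 2 + ‖P * R‖ ^ 2 := by
    rw [← frobenius_norm_add_sq, ← Matrix.mul_add, hR, add_sub_cancel]
    calc (P * (Y * b))ᴴ * (P * R) = bᴴ * ((Pᴴ * (P * Y))ᴴ * R) := by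
          simp only [conjTranspose_mul, conjTranspose_conjTranspose, Matrix.mul_assoc]
      _ = 0 := by
          simp [hP, Matrix.add_mul, Matrix.mul_assoc, hSR, hYR]
  have hPY : ‖P * Y‖ ^ 2 = ‖P * (Y * b)‖ ^ 2 + ‖P * (Y * D)‖ ^ 2 := by
    rw [← frobenius_norm_mul_conjTranspose_of_orthonormal hY (P * Y),
      frobenius_norm_sq_eq_add_of_orthonormal' hF]
    simp only [hD, hb, Matrix.mul_sub, Matrix.mul_assoc]
  have hRD : ‖R‖ ^ 2 = ‖D‖ ^ 2 := by
    have hFnorm : ‖F‖ ^ 2 = ‖Yᴴ‖ ^ 2 := by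
      rw [frobenius_norm_conjTranspose, frobenius_norm_sq_eq_trace, frobenius_norm_sq_eq_trace,
        hF, hY]
    rwa [frobenius_norm_sq_eq_add_of_orthonormal hY F,
      frobenius_norm_sq_eq_add_of_orthonormal' hF Yᴴ, add_right_inj] at hFnorm
  have hD' := habove D
  rw [frobenius_norm_mul_of_orthonormal hY, ← hRD] at hD'
  linarith [hbelow R hSR hYR]

end Minimality

section TotalLeastSquares

variable {α β ν δ : Type*} [Fintype δ] [DecidableEq δ]

/-- The matrix `[X; -1]`, so that `A X = B` reads `[A, B] [X; -1] = 0`. -/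
def augment {ν δ : Type*} [DecidableEq δ] (X : Matrix ν δ ℂ) : Matrix (ν ⊕ δ) δ ℂ :=
  fromRows X (-1)

theorem eq_of_augment_eq_mul {X X' : Matrix ν δ ℂ} {T : Matrix δ δ ℂ}
    (h : augment X' = augment X * T) : X' = X := by
  rw [augment, augment, fromRows_mul, Matrix.neg_mul, Matrix.one_mul, fromRows_inj.eq_iff] at h
  rw [h.1, ← neg_inj.mp h.2, Matrix.mul_one]

variable [Fintype ν]

theorem fromCols_zero_neg_one_mul_augment (X : Matrix ν δ ℂ) :
    fromCols (0 : Matrix δ ν ℂ) (-1 : Matrix δ δ ℂ) * augment X = 1 := by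
  simp [augment, fromCols_mul_fromRows]

/-- `E` is an admissible correction of `P` for `X`: the constraint `S [X; -1] = 0` holds, as does
the corrected equation `(P + E) [X; -1] = 0`. -/
def IsTLSFeasible (S : Matrix α (ν ⊕ δ) ℂ) (P : Matrix β (ν ⊕ δ) ℂ) (X : Matrix ν δ ℂ)
    (E : Matrix β (ν ⊕ δ) ℂ) : Prop :=
  S * augment X = 0 ∧ (P + E) * augment X = 0

theorem isTLSFeasible_neg_mul_conjTranspose {S : Matrix α (ν ⊕ δ) ℂ} {P : Matrix β (ν ⊕ δ) ℂ}
    {X : Matrix ν δ ℂ} {T : Matrix δ δ ℂ} (hS : S * augment X = 0) (hT : IsUnit T.det)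
    (horth : (augment X * T)ᴴ * (augment X * T) = 1) :
    IsTLSFeasible S P X (-(P * (augment X * T) * (augment X * T)ᴴ)) := by
  refine ⟨hS, ?_⟩
  set Y := augment X * T with hY
  have hXY : augment X = Y * T⁻¹ := by
    rw [hY, Matrix.mul_assoc, mul_nonsing_inv _ hT, Matrix.mul_one]
  clear_value Y
  rw [hXY, Matrix.add_mul, Matrix.neg_mul, Matrix.mul_assoc (P * Y), ← Matrix.mul_assoc Yᴴ, horth,
    Matrix.one_mul, Matrix.mul_assoc, add_neg_cancel]

variable [Fintype β]

/-- `X` solves the equality-constrained total least squares problem with data `S`, `P`. -/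
def IsTLSSolution (S : Matrix α (ν ⊕ δ) ℂ) (P : Matrix β (ν ⊕ δ) ℂ) (X : Matrix ν δ ℂ) : Prop :=
  ∃ E, IsTLSFeasible S P X E ∧ ∀ X' E', IsTLSFeasible S P X' E' → ‖E‖ ≤ ‖E'‖

theorem IsTLSFeasible.norm_mul_le {S : Matrix α (ν ⊕ δ) ℂ} {P E : Matrix β (ν ⊕ δ) ℂ}
    {X : Matrix ν δ ℂ} (h : IsTLSFeasible S P X E) {T : Matrix δ δ ℂ}
    (hT : (augment X * T)ᴴ * (augment X * T) = 1) : ‖P * (augment X * T)‖ ≤ ‖E‖ := by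
  have hE : P * (augment X * T) = -(E * (augment X * T)) := by
    rw [eq_neg_iff_add_eq_zero, ← Matrix.add_mul, ← Matrix.mul_assoc, h.2, Matrix.zero_mul]
  rw [hE, norm_neg]
  exact frobenius_norm_mul_le_of_orthonormal hT E

theorem IsTLSFeasible.exists_norm_mul_sq_add_gap_le [Fintype α] {S : Matrix α (ν ⊕ δ) ℂ}
    {P E : Matrix β (ν ⊕ δ) ℂ} {X : Matrix ν δ ℂ} {Y : Matrix (ν ⊕ δ) δ ℂ} {Λ : Matrix α δ ℂ}
    {M : Matrix δ δ ℂ} {c c' : ℝ} (h : IsTLSFeasible S P X E) (hY : Yᴴ * Y = 1) (hSY : S * Y = 0)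
    (hP : Pᴴ * (P * Y) = Sᴴ * Λ + Y * M) (habove : BoundedAboveOnRange P Y c)
    (hbelow : BoundedBelowOnOrthogonal S P Y c') :
    ∃ T : Matrix δ δ ℂ, IsUnit T.det ∧
      ‖P * Y‖ ^ 2 + (c' - c) * ‖augment X * T - Y * (Yᴴ * (augment X * T))‖ ^ 2 ≤ ‖E‖ ^ 2 := by
  obtain ⟨T, hT, hFo⟩ :=
    exists_orthonormal_mul_of_leftInverse (fromCols_zero_neg_one_mul_augment X)
  refine ⟨T, hT, (norm_mul_sq_add_gap_le hY hFo hSY ?_ hP habove hbelow).trans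
    (pow_le_pow_left₀ (norm_nonneg _) (h.norm_mul_le hFo) 2)⟩
  rw [← Matrix.mul_assoc, h.1, Matrix.zero_mul]

theorem existsUnique_isTLSSolution [Fintype α] {S : Matrix α (ν ⊕ δ) ℂ}
    {P : Matrix β (ν ⊕ δ) ℂ} {X : Matrix ν δ ℂ} {Λ : Matrix α δ ℂ} {M : Matrix δ δ ℂ} {c c' : ℝ}
    (hc : c < c') (hS : S * augment X = 0)
    (hP : Pᴴ * (P * augment X) = Sᴴ * Λ + augment X * M)
    (habove : BoundedAboveOnRange P (augment X) c)
    (hbelow : BoundedBelowOnOrthogonal S P (augment X) c') :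
    IsTLSSolution S P X ∧ ∀ X', IsTLSSolution S P X' → X' = X := by
  obtain ⟨T, hT, hYo⟩ :=
    exists_orthonormal_mul_of_leftInverse (fromCols_zero_neg_one_mul_augment X)
  have hfeas := isTLSFeasible_neg_mul_conjTranspose (P := P) hS hT hYo
  have hnorm : ‖-(P * (augment X * T) * (augment X * T)ᴴ)‖ = ‖P * (augment X * T)‖ := by
    rw [norm_neg, frobenius_norm_mul_conjTranspose_of_orthonormal hYo]
  set Y := augment X * T with hY
  have hSY : S * Y = 0 := by rw [hY, ← Matrix.mul_assoc, hS, Matrix.zero_mul]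
  have hPY : Pᴴ * (P * Y) = Sᴴ * (Λ * T) + Y * (T⁻¹ * (M * T)) := by
    rw [hY, ← Matrix.mul_assoc P, ← Matrix.mul_assoc Pᴴ, hP, Matrix.mul_assoc (augment X),
      mul_nonsing_inv_cancel_left _ _ hT, Matrix.add_mul, Matrix.mul_assoc, Matrix.mul_assoc]
  have hgap {X' E'} (h' : IsTLSFeasible S P X' E') :=
    h'.exists_norm_mul_sq_add_gap_le hYo hSY hPY (habove.mul_right T) (hbelow.mul_right hT)
  refine ⟨⟨_, hfeas, fun X' E' h' => ?_⟩, fun X' ⟨E', h', hmin⟩ => ?_⟩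
  · obtain ⟨T', -, h⟩ := hgap h'
    rw [hnorm]
    exact le_of_sq_le_sq (le_trans (le_add_of_nonneg_right
      (mul_nonneg (sub_nonneg.2 hc.le) (sq_nonneg _))) h) (norm_nonneg _)
  · obtain ⟨T', hT', h⟩ := hgap h'
    have hle : ‖E'‖ ^ 2 ≤ ‖P * Y‖ ^ 2 :=
      pow_le_pow_left₀ (norm_nonneg _) (hnorm ▸ hmin X _ hfeas) 2
    have hzero : ‖augment X' * T' - Y * (Yᴴ * (augment X' * T'))‖ ^ 2 ≤ 0 :=
      nonpos_of_mul_nonpos_right (by linarith) (sub_pos.2 hc)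
    have hF : augment X' * T' = Y * (Yᴴ * (augment X' * T')) := by
      simpa [sub_eq_zero] using le_antisymm hzero (sq_nonneg _)
    refine eq_of_augment_eq_mul (T := T * (Yᴴ * (augment X' * T')) * T'⁻¹) ?_
    rw [← Matrix.mul_assoc, ← Matrix.mul_assoc, ← hY, ← hF, mul_nonsing_inv_cancel_right _ _ hT']

end TotalLeastSquares

/-! ### Stability of spectral gaps -/

section Stability

theorem eventually_forall_of_forall_unit_sphere {E Z : Type*} [NormedAddCommGroup E]
    [NormedSpace ℝ E] [FiniteDimensional ℝ E] [TopologicalSpace Z] {z₀ : Z} {p : Z → E → Prop}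
    (hsmul : ∀ z r, ∀ t : ℝ, 0 < t → p z (t • r) → p z r) (hzero : ∀ z, p z 0)
    (h : ∀ r : E, ‖r‖ = 1 → ∀ᶠ w : Z × E in 𝓝 (z₀, r), p w.1 w.2) :
    ∀ᶠ z in 𝓝 z₀, ∀ r, p z r := by
  have : ProperSpace E := FiniteDimensional.proper ℝ E
  filter_upwards [(isCompact_sphere (0 : E) 1).eventually_forall_of_forall_eventually
    fun r hr => h r (mem_sphere_zero_iff_norm.1 hr)] with z hz r
  rcases eq_or_ne r 0 with rfl | hr
  · exact hzero z
  · refine hsmul z r ‖r‖⁻¹ (inv_pos.2 (norm_pos_iff.2 hr)) (hz _ ?_)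
    simp [norm_smul, hr]

variable {α β κ δ : Type*} [Fintype β] [Fintype κ] [Fintype δ]

theorem BoundedAboveOnRange.eventually [DecidableEq δ] {P : Matrix β κ ℂ} {Y : Matrix κ δ ℂ}
    {L : Matrix δ κ ℂ} {c₀ c : ℝ} (h : BoundedAboveOnRange P Y c₀) (hL : L * Y = 1) (hc : c₀ < c) :
    ∀ᶠ z : Matrix β κ ℂ × Matrix κ δ ℂ in 𝓝 (P, Y), BoundedAboveOnRange z.1 z.2 c := by
  refine eventually_forall_of_forall_unit_sphere (fun z x t ht hx => ?_) (fun z => by simp)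
    fun x hx => ?_
  · simp only [Matrix.mul_smul, norm_smul, mul_pow, mul_left_comm c] at hx
    exact le_of_mul_le_mul_left hx (pow_pos (norm_pos_iff.2 ht.ne') 2)
  · have hYx : Y * x ≠ 0 := fun h0 => by
      have hx0 : x = 0 := by rw [← Matrix.one_mul x, ← hL, Matrix.mul_assoc, h0, Matrix.mul_zero]
      simp [hx0] at hx
    have hlt : ‖P * (Y * x)‖ ^ 2 < c * ‖Y * x‖ ^ 2 :=
      (h x).trans_lt (mul_lt_mul_of_pos_right hc (by positivity))
    have hcont : ContinuousAt (fun w : (Matrix β κ ℂ × Matrix κ δ ℂ) × Matrix δ κ ℂ =>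
        c * ‖w.1.2 * w.2‖ ^ 2 - ‖w.1.1 * (w.1.2 * w.2)‖ ^ 2) ((P, Y), x) := by fun_prop
    filter_upwards [hcont.eventually_const_lt (sub_pos.2 hlt)] with w hw
    exact (sub_pos.1 hw).le

theorem BoundedBelowOnOrthogonal.eventually {S : Matrix α κ ℂ} {P : Matrix β κ ℂ}
    {Y : Matrix κ δ ℂ} {c₀ c : ℝ} (h : BoundedBelowOnOrthogonal S P Y c₀) (hc : c < c₀) :
    ∀ᶠ z : Matrix α κ ℂ × Matrix β κ ℂ × Matrix κ δ ℂ in 𝓝 (S, P, Y),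
      BoundedBelowOnOrthogonal z.1 z.2.1 z.2.2 c := by
  refine eventually_forall_of_forall_unit_sphere (fun z r t ht hr hS hY => ?_) (fun z => by simp)
    fun r hr => ?_
  · simp only [Matrix.mul_smul, norm_smul, mul_pow, mul_left_comm c, hS, hY, smul_zero,
      forall_const] at hr
    exact le_of_mul_le_mul_left hr (pow_pos (norm_pos_iff.2 ht.ne') 2)
  · by_cases hSr : S * r = 0
    · by_cases hYr : Yᴴ * r = 0
      · have hlt : c * ‖r‖ ^ 2 < ‖P * r‖ ^ 2 :=
          (mul_lt_mul_of_pos_right hc (by simp [hr])).trans_le (h r hSr hYr)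
        have hcont : ContinuousAt
            (fun w : (Matrix α κ ℂ × Matrix β κ ℂ × Matrix κ δ ℂ) × Matrix κ δ ℂ =>
              ‖w.1.2.1 * w.2‖ ^ 2 - c * ‖w.2‖ ^ 2) ((S, P, Y), r) := by fun_prop
        filter_upwards [hcont.eventually_const_lt (sub_pos.2 hlt)] with w hw _ _
        exact (sub_pos.1 hw).le
      · have hcont : ContinuousAt
            (fun w : (Matrix α κ ℂ × Matrix β κ ℂ × Matrix κ δ ℂ) × Matrix κ δ ℂ =>
              w.1.2.2ᴴ * w.2) ((S, P, Y), r) := by fun_prop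
        filter_upwards [hcont.eventually_ne hYr] with w hw _ hw'
        exact absurd hw' hw
    · have hcont : ContinuousAt
          (fun w : (Matrix α κ ℂ × Matrix β κ ℂ × Matrix κ δ ℂ) × Matrix κ δ ℂ =>
            w.1.1 * w.2) ((S, P, Y), r) := by fun_prop
      filter_upwards [hcont.eventually_ne hSr] with w hw hw'
      exact absurd hw' hw

end Stability

/-! ### The stationarity equations and their linearization -/

section Stationarity

theorem exists_hasStrictFDerivAt_matrix_mul {E α β γ : Type*} [NormedAddCommGroup E]
    [NormedSpace ℝ E] [Finite α] [Fintype β] [Finite γ]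
    {f : E → Matrix α β ℂ} {g : E → Matrix β γ ℂ} {f' : E →L[ℝ] Matrix α β ℂ}
    {g' : E →L[ℝ] Matrix β γ ℂ} {x : E}
    (hf : HasStrictFDerivAt f f' x) (hg : HasStrictFDerivAt g g' x) :
    ∃ h' : E →L[ℝ] Matrix α γ ℂ, HasStrictFDerivAt (fun y => f y * g y) h' x ∧
      ∀ v, h' v = f x * g' v + f' v * g x := by
  cases nonempty_fintype α
  cases nonempty_fintype γ
  have hmul : IsBoundedBilinearMap ℝ (fun z : Matrix α β ℂ × Matrix β γ ℂ => z.1 * z.2) :=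
    { add_left := Matrix.add_mul
      smul_left := Matrix.smul_mul
      add_right := Matrix.mul_add
      smul_right := fun t A B => Matrix.mul_smul A t B
      bound := ⟨1, one_pos, fun A B => by simpa only [one_mul] using frobenius_norm_mul A B⟩ }
  exact ⟨_, (hmul.hasStrictFDerivAt (f x, g x)).comp x (hf.prodMk hg), fun v => rfl⟩

theorem exists_hasStrictFDerivAt_augment {E ν δ : Type*} [NormedAddCommGroup E]
    [NormedSpace ℝ E] [Finite ν] [Finite δ] [DecidableEq δ] {f : E → Matrix ν δ ℂ}
    {f' : E →L[ℝ] Matrix ν δ ℂ} {x : E} (hf : HasStrictFDerivAt f f' x) :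
    ∃ h' : E →L[ℝ] Matrix (ν ⊕ δ) δ ℂ, HasStrictFDerivAt (fun y => augment (f y)) h' x ∧
      ∀ v, h' v = fromRows (f' v) 0 := by
  cases nonempty_fintype ν
  cases nonempty_fintype δ
  let ι : Matrix ν δ ℂ →ₗ[ℝ] Matrix (ν ⊕ δ) δ ℂ :=
    { toFun := fun X => fromRows X 0
      map_add' := fun X X' => by ext (i | i) j <;> simp
      map_smul' := fun t X => by ext (i | i) j <;> simp }
  refine ⟨ι.toContinuousLinearMap ∘L f', ?_, fun v => rfl⟩
  refine ((ι.toContinuousLinearMap.hasStrictFDerivAt.comp x hf).add_const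
    (fromRows 0 (-1))).congr_of_eventuallyEq (Eventually.of_forall fun v => ?_)
  ext (i | i) j <;> simp [augment, ι]

variable {α β ν δ : Type*} [Fintype α] [Fintype β] [Fintype ν] [Fintype δ] [DecidableEq δ]

/-- The defects of the constraint `S Y = 0` and of the stationarity condition
`Pᴴ P Y = Sᴴ Λ + Y M`, for the stacked data `N = [S; P]` and `Y = [X; -1]`. -/
def stationarity :
    Matrix (α ⊕ β) (ν ⊕ δ) ℂ × Matrix ν δ ℂ × Matrix α δ ℂ × Matrix δ δ ℂ →
      Matrix α δ ℂ × Matrix (ν ⊕ δ) δ ℂ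
  | (N, X, Λ, M) =>
    (N.toRows₁ * augment X,
      N.toRows₂ᴴ * (N.toRows₂ * augment X) - (N.toRows₁ᴴ * Λ + augment X * M))

/-- The directional derivative of `stationarity` at `(N, X, Λ, M)` along `(ΔN, ΔX, ΔΛ, ΔM)`. -/
def stationarityDeriv :
    Matrix (α ⊕ β) (ν ⊕ δ) ℂ × Matrix ν δ ℂ × Matrix α δ ℂ × Matrix δ δ ℂ →
      Matrix (α ⊕ β) (ν ⊕ δ) ℂ × Matrix ν δ ℂ × Matrix α δ ℂ × Matrix δ δ ℂ →
        Matrix α δ ℂ × Matrix (ν ⊕ δ) δ ℂ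
  | (N, X, Λ, M), (ΔN, ΔX, ΔΛ, ΔM) =>
    (N.toRows₁ * fromRows ΔX (0 : Matrix δ δ ℂ) + ΔN.toRows₁ * augment X,
      N.toRows₂ᴴ * (N.toRows₂ * fromRows ΔX (0 : Matrix δ δ ℂ) + ΔN.toRows₂ * augment X) +
          ΔN.toRows₂ᴴ * (N.toRows₂ * augment X) -
        (N.toRows₁ᴴ * ΔΛ + ΔN.toRows₁ᴴ * Λ + (augment X * ΔM + fromRows ΔX 0 * M)))

theorem exists_hasStrictFDerivAt_stationarity
    (w : Matrix (α ⊕ β) (ν ⊕ δ) ℂ × Matrix ν δ ℂ × Matrix α δ ℂ × Matrix δ δ ℂ) :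
    ∃ L : (Matrix (α ⊕ β) (ν ⊕ δ) ℂ × Matrix ν δ ℂ × Matrix α δ ℂ × Matrix δ δ ℂ) →L[ℝ]
        Matrix α δ ℂ × Matrix (ν ⊕ δ) δ ℂ,
      HasStrictFDerivAt stationarity L w ∧ ∀ v, L v = stationarityDeriv w v := by
  let rows₁ : Matrix (α ⊕ β) (ν ⊕ δ) ℂ →ₗ[ℝ] Matrix α (ν ⊕ δ) ℂ :=
    { toFun := toRows₁, map_add' := fun _ _ => rfl, map_smul' := fun _ _ => rfl }
  let rows₂ : Matrix (α ⊕ β) (ν ⊕ δ) ℂ →ₗ[ℝ] Matrix β (ν ⊕ δ) ℂ :=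
    { toFun := toRows₂, map_add' := fun _ _ => rfl, map_smul' := fun _ _ => rfl }
  let adj₁ : Matrix α (ν ⊕ δ) ℂ →ₗ[ℝ] Matrix (ν ⊕ δ) α ℂ :=
    (conjTransposeLinearEquiv α (ν ⊕ δ) ℝ ℂ).toLinearMap
  let adj₂ : Matrix β (ν ⊕ δ) ℂ →ₗ[ℝ] Matrix (ν ⊕ δ) β ℂ :=
    (conjTransposeLinearEquiv β (ν ⊕ δ) ℝ ℂ).toLinearMap
  have hN := hasStrictFDerivAt_fst (𝕜 := ℝ) (p := w)
  have hw₂ := hasStrictFDerivAt_snd (𝕜 := ℝ) (p := w)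
  have hS := rows₁.toContinuousLinearMap.hasStrictFDerivAt.comp w hN
  have hP := rows₂.toContinuousLinearMap.hasStrictFDerivAt.comp w hN
  have hSstar := adj₁.toContinuousLinearMap.hasStrictFDerivAt.comp w hS
  have hPstar := adj₂.toContinuousLinearMap.hasStrictFDerivAt.comp w hP
  obtain ⟨Y', hY, hY'⟩ := exists_hasStrictFDerivAt_augment hw₂.fst
  obtain ⟨SY', hSY, hSY'⟩ := exists_hasStrictFDerivAt_matrix_mul hS hY
  obtain ⟨PY', hPY, hPY'⟩ := exists_hasStrictFDerivAt_matrix_mul hP hY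
  obtain ⟨PPY', hPPY, hPPY'⟩ := exists_hasStrictFDerivAt_matrix_mul hPstar hPY
  obtain ⟨SΛ', hSΛ, hSΛ'⟩ := exists_hasStrictFDerivAt_matrix_mul hSstar hw₂.snd.fst
  obtain ⟨YM', hYM, hYM'⟩ := exists_hasStrictFDerivAt_matrix_mul hY hw₂.snd.snd
  refine ⟨_, hSY.prodMk (hPPY.sub (hSΛ.add hYM)), fun v => ?_⟩
  change (SY' v, PPY' v - (SΛ' v + YM' v)) = _
  rw [hSY', hPPY', hPY', hSΛ', hYM', hY']
  rfl

end Stationarity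

theorem exists_implicit_solution {E₁ E₂ F : Type*}
    [NormedAddCommGroup E₁] [NormedSpace ℝ E₁] [FiniteDimensional ℝ E₁]
    [NormedAddCommGroup E₂] [NormedSpace ℝ E₂] [FiniteDimensional ℝ E₂]
    [NormedAddCommGroup F] [NormedSpace ℝ F] [FiniteDimensional ℝ F]
    {f : E₁ × E₂ → F} {L : E₁ × E₂ →L[ℝ] F} {a : E₁ × E₂} (hL : HasStrictFDerivAt f L a)
    (hinj : ∀ u, L (0, u) = 0 → u = 0) (hdim : Module.finrank ℝ E₂ = Module.finrank ℝ F)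
    (h0 : f a = 0) :
    ∃ (ψ : E₁ → E₂) (ψ' : E₁ →L[ℝ] E₂), HasFDerivAt ψ ψ' a.1 ∧ Tendsto ψ (𝓝 a.1) (𝓝 a.2) ∧
      (∀ᶠ x in 𝓝 a.1, f (x, ψ x) = 0) ∧ ∀ v, L (v, ψ' v) = 0 := by
  have := FiniteDimensional.complete ℝ E₁
  have := FiniteDimensional.complete ℝ E₂
  have := FiniteDimensional.complete ℝ F
  have hinj' : Function.Injective (L ∘L .inr ℝ E₁ E₂).toLinearMap :=
    (injective_iff_map_eq_zero _).2 hinj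
  have hinv : (L ∘L .inr ℝ E₁ E₂).IsInvertible :=
    ⟨(LinearMap.linearEquivOfInjective _ hinj' hdim).toContinuousLinearEquiv, rfl⟩
  refine ⟨_, _, (hL.hasStrictFDerivAt_implicitFunctionOfProdDomain hinv).hasFDerivAt,
    hL.tendsto_implicitFunctionOfProdDomain hinv, ?_, fun v => ?_⟩
  · simpa only [h0] using hL.eventually_apply_implicitFunctionOfProdDomain hinv
  · obtain ⟨e, he⟩ := hinv
    have h1 : ∀ u, L (v, u) = L (v, 0) + e u := by
      intro u
      have : e u = L (0, u) := DFunLike.congr_fun he u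
      rw [this, ← map_add]
      simp
    rw [h1, ← he, ContinuousLinearMap.inverse_equiv]
    simp

/-! ### Constrained singular value decompositions -/

section Diagonal

variable {α β γ : Type*} [DecidableEq α]

theorem rdiag_conjTranspose (s : α → ℝ) : (rdiag s)ᴴ = rdiag s := by
  simp [rdiag, diagonal_conjTranspose, Pi.star_def]

variable [Fintype α]

theorem rdiag_mul_apply (s : α → ℝ) (A : Matrix α β ℂ) (i : α) (j : β) :
    (rdiag s * A) i j = s i * A i j := by
  simp [rdiag]

theorem mul_rdiag_apply (s : α → ℝ) (A : Matrix β α ℂ) (i : β) (j : α) :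
    (A * rdiag s) i j = A i j * s j := by
  simp [rdiag]

theorem eq_zero_of_rdiag_mul_eq_zero {s : α → ℝ} (hs : ∀ i, 0 < s i) {A : Matrix α β ℂ}
    (h : rdiag s * A = 0) : A = 0 := by
  ext i j
  have hij := congrFun₂ h i j
  rw [rdiag_mul_apply] at hij
  exact (mul_eq_zero.1 hij).resolve_left (Complex.ofReal_ne_zero.2 (hs i).ne')

theorem frobenius_norm_rdiag_mul_sq [Fintype β] (s : α → ℝ) (A : Matrix α β ℂ) :
    ‖rdiag s * A‖ ^ 2 = ∑ i, ∑ j, s i ^ 2 * ‖A i j‖ ^ 2 := by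
  simp [frobenius_norm_sq, rdiag_mul_apply, mul_pow]

theorem frobenius_norm_rdiag_mul_sq_le [Fintype β] {s : α → ℝ} {c : ℝ} (hs : ∀ i, s i ^ 2 ≤ c)
    (A : Matrix α β ℂ) : ‖rdiag s * A‖ ^ 2 ≤ c * ‖A‖ ^ 2 := by
  rw [frobenius_norm_rdiag_mul_sq, frobenius_norm_sq]
  simp only [Finset.mul_sum]
  gcongr
  exact hs _

theorem le_frobenius_norm_rdiag_mul_sq [Fintype β] {s : α → ℝ} {c : ℝ} (hs : ∀ i, c ≤ s i ^ 2)
    (A : Matrix α β ℂ) : c * ‖A‖ ^ 2 ≤ ‖rdiag s * A‖ ^ 2 := by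
  rw [frobenius_norm_rdiag_mul_sq, frobenius_norm_sq]
  simp only [Finset.mul_sum]
  gcongr
  exact hs _

end Diagonal

section ThinSVD

variable {α β γ : Type*} [Fintype α] [Fintype β] [Fintype γ] [DecidableEq γ]
  {A : Matrix α β ℂ} {U : Matrix α γ ℂ} {s : γ → ℝ} {V : Matrix β γ ℂ}

theorem IsThinSVD.mul_right (h : IsThinSVD A U s V) : A * V = U * rdiag s := by
  rw [h.factor, Matrix.mul_assoc, h.right_orthonormal, Matrix.mul_one]

theorem IsThinSVD.conjTranspose_mul (h : IsThinSVD A U s V) : Uᴴ * A = rdiag s * Vᴴ := by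
  rw [h.factor, ← Matrix.mul_assoc, ← Matrix.mul_assoc, h.left_orthonormal, Matrix.one_mul]

theorem IsThinSVD.conjTranspose_mul_eq_zero {ι : Type*} (h : IsThinSVD A U s V) {R : Matrix β ι ℂ}
    (hR : A * R = 0) : Vᴴ * R = 0 := by
  refine eq_zero_of_rdiag_mul_eq_zero h.pos ?_
  rw [← Matrix.mul_assoc, ← h.conjTranspose_mul, Matrix.mul_assoc, hR, Matrix.mul_zero]

end ThinSVD

theorem orthonormal_toCols {α β γ : Type*} [Fintype α] [DecidableEq β] [DecidableEq γ]
    {U : Matrix α (β ⊕ γ) ℂ} (h : Uᴴ * U = 1) :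
    U.toCols₁ᴴ * U.toCols₁ = 1 ∧ U.toCols₁ᴴ * U.toCols₂ = 0 ∧ U.toCols₂ᴴ * U.toCols₂ = 1 := by
  rw [← fromCols_toCols U, conjTranspose_fromCols_eq_fromRows_conjTranspose,
    fromRows_mul_fromCols, ← fromBlocks_one, fromBlocks_inj] at h
  exact ⟨h.1, h.2.1, h.2.2.2⟩

theorem toRows₁_conjTranspose_mul_mul {ν δ ι κ τ : Type*} [Fintype ν] [Fintype δ] [Fintype κ]
    (A : Matrix (ν ⊕ δ) ι ℂ) (X : Matrix ν κ ℂ) (B : Matrix κ τ ℂ) :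
    A.toRows₁ᴴ * X * B = Aᴴ * (fromRows X (0 : Matrix δ κ ℂ) * B) := by
  conv_rhs => rw [← fromRows_toRows A, conjTranspose_fromRows_eq_fromCols_conjTranspose,
    ← Matrix.mul_assoc, fromCols_mul_fromRows, Matrix.mul_zero, add_zero]

theorem exists_separation {ι κ : Type*} [Finite ι] [Finite κ] {f : ι → ℝ} {g : κ → ℝ}
    (h : ∀ i j, f i < g j) : ∃ a b, a < b ∧ (∀ i, f i ≤ a) ∧ ∀ j, b ≤ g j := by
  have := Fintype.ofFinite ι
  have := Fintype.ofFinite κ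
  obtain ⟨a, hfa, hag⟩ := Order.exists_between_finsets (Finset.univ.image f)
    (Finset.univ.image g) (by simpa using h)
  obtain ⟨b, hab, hbg⟩ :=
    Order.exists_between_finsets {a} (Finset.univ.image g) (by simpa using hag)
  simp only [Finset.mem_image, Finset.mem_univ, true_and, forall_exists_index,
    forall_apply_eq_imp_iff, Finset.mem_singleton, forall_eq] at hfa hab hbg
  exact ⟨a, b, hab, fun i => (hfa i).le, fun j => (hbg j).le⟩

/-- Simultaneous decompositions `S = Us diag(s) Vsᴴ` and `P = T S + U diag(σ₁, σ₂) Vᴴ` with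
`[Vs, V]` unitary, in which every `σ₁ i` exceeds every `σ₂ j`. With `T = P S†` this is the thin
singular value decomposition of `P` on the kernel of `S`; invertibility of the block `V₂₂` makes
the total least squares problem for `S`, `P` generic. -/
structure ConstrainedSVD {α β ν δ : Type*} [Fintype α] [DecidableEq α] [Fintype β] [Fintype ν]
    [DecidableEq ν] [Fintype δ] [DecidableEq δ] (S : Matrix α (ν ⊕ δ) ℂ) (P : Matrix β (ν ⊕ δ) ℂ)
    (γ : Type*) [Fintype γ] [DecidableEq γ] where
  /-- left singular vectors of `S` -/
  Us : Matrix α α ℂ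
  /-- singular values of `S` -/
  s : α → ℝ
  /-- right singular vectors of `S` -/
  Vs : Matrix (ν ⊕ δ) α ℂ
  /-- the matrix `P S†` -/
  T : Matrix β α ℂ
  /-- left singular vectors of `P` on the kernel of `S` -/
  U : Matrix β (γ ⊕ δ) ℂ
  /-- the large singular values -/
  σ₁ : γ → ℝ
  /-- the small singular values -/
  σ₂ : δ → ℝ
  /-- right singular vectors of `P` on the kernel of `S` -/
  V : Matrix (ν ⊕ δ) (γ ⊕ δ) ℂ
  svd_left : IsThinSVD S Us s Vs
  svd_right : IsThinSVD (P - T * S) U (Sum.elim σ₁ σ₂) V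
  complete : Vs * Vsᴴ + V * Vᴴ = 1
  gap : ∀ i j, σ₂ j < σ₁ i
  isUnit_det : IsUnit V.toBlocks₂₂.det

namespace ConstrainedSVD

variable {α β γ ν δ : Type*} [Fintype α] [DecidableEq α] [Fintype β] [Fintype γ] [DecidableEq γ]
  [Fintype ν] [DecidableEq ν] [Fintype δ] [DecidableEq δ]
  {S : Matrix α (ν ⊕ δ) ℂ} {P : Matrix β (ν ⊕ δ) ℂ} (F : ConstrainedSVD S P γ)

/-- Left singular vectors for the large singular values. -/
abbrev U₁ : Matrix β γ ℂ := F.U.toCols₁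

/-- Left singular vectors for the small singular values. -/
abbrev U₂ : Matrix β δ ℂ := F.U.toCols₂

/-- Right singular vectors for the large singular values. -/
abbrev V₁ : Matrix (ν ⊕ δ) γ ℂ := F.V.toCols₁

/-- Right singular vectors for the small singular values. -/
abbrev V₂ : Matrix (ν ⊕ δ) δ ℂ := F.V.toCols₂

/-- The last `δ` rows of `V₂`. -/
abbrev V₂₂ : Matrix δ δ ℂ := F.V.toBlocks₂₂

/-- The solution `-V₁₂ V₂₂⁻¹` of the total least squares problem. -/
def sol : Matrix ν δ ℂ := -(F.V.toBlocks₁₂ * F.V₂₂⁻¹)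

/-- The multiplier of the constraint at the solution. -/
def multiplier : Matrix α δ ℂ := -(F.Tᴴ * F.U₂ * rdiag F.σ₂) * F.V₂₂⁻¹

/-- The matrix of `Pᴴ P` on the span of `[X; -1]`, modulo the row space of `S`. -/
def compression : Matrix δ δ ℂ := F.V₂₂ * (rdiag F.σ₂ * rdiag F.σ₂) * F.V₂₂⁻¹

theorem Vs_mul_V : F.Vsᴴ * F.V = 0 := by
  have h : F.Vsᴴ * (F.Vs * F.Vsᴴ + F.V * F.Vᴴ) * F.V = F.Vsᴴ * F.V := by
    rw [F.complete, Matrix.mul_one]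
  rw [Matrix.mul_add, ← Matrix.mul_assoc, F.svd_left.right_orthonormal, Matrix.one_mul,
    Matrix.add_mul, Matrix.mul_assoc, Matrix.mul_assoc, F.svd_right.right_orthonormal,
    Matrix.mul_one] at h
  exact add_eq_left.1 h

theorem S_mul_V : S * F.V = 0 := by
  have h : S * F.V = F.Us * rdiag F.s * F.Vsᴴ * F.V := congrArg (· * F.V) F.svd_left.factor
  rw [h, Matrix.mul_assoc, F.Vs_mul_V, Matrix.mul_zero]

theorem S_mul_V₁ : S * F.V₁ = 0 := congrArg toCols₁ F.S_mul_V

theorem S_mul_V₂ : S * F.V₂ = 0 := congrArg toCols₂ F.S_mul_V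

theorem P_mul_V : P * F.V = F.U * rdiag (Sum.elim F.σ₁ F.σ₂) := by
  rw [← F.svd_right.mul_right, Matrix.sub_mul, Matrix.mul_assoc, F.S_mul_V, Matrix.mul_zero,
    sub_zero]

theorem P_mul_V₁ : P * F.V₁ = F.U₁ * rdiag F.σ₁ := by
  refine (congrArg toCols₁ F.P_mul_V).trans ?_
  ext i j
  simp [mul_rdiag_apply]

theorem P_mul_V₂ : P * F.V₂ = F.U₂ * rdiag F.σ₂ := by
  refine (congrArg toCols₂ F.P_mul_V).trans ?_
  ext i j
  simp [mul_rdiag_apply]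

theorem U_mul_P : F.Uᴴ * P = F.Uᴴ * (F.T * S) + rdiag (Sum.elim F.σ₁ F.σ₂) * F.Vᴴ := by
  rw [← F.svd_right.conjTranspose_mul, Matrix.mul_sub, add_sub_cancel]

theorem U₁_mul_P : F.U₁ᴴ * P = F.U₁ᴴ * (F.T * S) + rdiag F.σ₁ * F.V₁ᴴ := by
  have h : (rdiag (Sum.elim F.σ₁ F.σ₂) * F.Vᴴ).toRows₁ = rdiag F.σ₁ * F.V₁ᴴ := by
    ext i j
    rw [toRows₁_apply, rdiag_mul_apply, rdiag_mul_apply]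
    rfl
  rw [← h]
  exact congrArg toRows₁ F.U_mul_P

theorem U₂_mul_P : F.U₂ᴴ * P = F.U₂ᴴ * (F.T * S) + rdiag F.σ₂ * F.V₂ᴴ := by
  have h : (rdiag (Sum.elim F.σ₁ F.σ₂) * F.Vᴴ).toRows₂ = rdiag F.σ₂ * F.V₂ᴴ := by
    ext i j
    rw [toRows₂_apply, rdiag_mul_apply, rdiag_mul_apply]
    rfl
  rw [← h]
  exact congrArg toRows₂ F.U_mul_P

theorem V_mul_conjTranspose : F.V * F.Vᴴ = F.V₁ * F.V₁ᴴ + F.V₂ * F.V₂ᴴ := by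
  conv_lhs => rw [← fromCols_toCols F.V]
  rw [conjTranspose_fromCols_eq_fromRows_conjTranspose, fromCols_mul_fromRows]

theorem augment_sol : augment F.sol = F.V₂ * -F.V₂₂⁻¹ := by
  have h : F.V₂ = fromRows F.V.toBlocks₁₂ F.V₂₂ := (fromRows_toRows _).symm
  rw [h, fromRows_mul, augment, sol, Matrix.mul_neg, Matrix.mul_neg,
    mul_nonsing_inv _ F.isUnit_det]

theorem augment_sol_mul_V₂₂ : augment F.sol * F.V₂₂ = -F.V₂ := by
  rw [F.augment_sol, Matrix.mul_neg, Matrix.neg_mul, nonsing_inv_mul_cancel_right _ _ F.isUnit_det]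

theorem multiplier_mul_V₂₂ : F.multiplier * F.V₂₂ = -(F.Tᴴ * (F.U₂ * rdiag F.σ₂)) := by
  rw [multiplier, nonsing_inv_mul_cancel_right _ _ F.isUnit_det, Matrix.mul_assoc]

theorem compression_mul_V₂₂ : F.compression * F.V₂₂ = F.V₂₂ * (rdiag F.σ₂ * rdiag F.σ₂) := by
  rw [compression, nonsing_inv_mul_cancel_right _ _ F.isUnit_det]

theorem eq_zero_of_mul_V₂₂ {ι : Type*} {A : Matrix ι δ ℂ} (h : A * F.V₂₂ = 0) : A = 0 := by
  rw [← mul_nonsing_inv_cancel_right _ A F.isUnit_det, h, Matrix.zero_mul]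

theorem S_mul_augment_sol : S * augment F.sol = 0 := by
  rw [F.augment_sol, ← Matrix.mul_assoc, F.S_mul_V₂, Matrix.zero_mul]

theorem gram_mul_V₂ : Pᴴ * (P * F.V₂) =
    Sᴴ * (F.Tᴴ * (F.U₂ * rdiag F.σ₂)) + F.V₂ * (rdiag F.σ₂ * rdiag F.σ₂) := by
  have h : Pᴴ * F.U₂ = Sᴴ * (F.Tᴴ * F.U₂) + F.V₂ * rdiag F.σ₂ := by
    simpa only [conjTranspose_mul, conjTranspose_add, conjTranspose_conjTranspose,
      rdiag_conjTranspose, Matrix.mul_assoc] using congrArg conjTranspose F.U₂_mul_P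
  rw [F.P_mul_V₂, ← Matrix.mul_assoc, h]
  simp only [Matrix.add_mul, Matrix.mul_assoc]

theorem stationarity_sol :
    stationarity (fromRows S P, F.sol, F.multiplier, F.compression) = 0 := by
  refine Prod.ext F.S_mul_augment_sol (F.eq_zero_of_mul_V₂₂ ?_)
  dsimp only [stationarity]
  rw [toRows₁_fromRows, toRows₂_fromRows, Matrix.sub_mul, Matrix.add_mul]
  simp only [Matrix.mul_assoc, F.augment_sol_mul_V₂₂, F.multiplier_mul_V₂₂, F.compression_mul_V₂₂]
  rw [← Matrix.mul_assoc (augment _), F.augment_sol_mul_V₂₂, Matrix.mul_neg, Matrix.mul_neg,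
    F.gram_mul_V₂, Matrix.mul_neg, Matrix.neg_mul]
  abel

theorem boundedAboveOnRange_V₂ {c : ℝ} (hc : ∀ j, F.σ₂ j ^ 2 ≤ c) :
    BoundedAboveOnRange P F.V₂ c := fun x => by
  have hV := (orthonormal_toCols F.svd_right.right_orthonormal).2.2
  have hU := (orthonormal_toCols F.svd_right.left_orthonormal).2.2
  rw [← Matrix.mul_assoc, F.P_mul_V₂, Matrix.mul_assoc, frobenius_norm_mul_of_orthonormal hU,
    frobenius_norm_mul_of_orthonormal hV]
  exact frobenius_norm_rdiag_mul_sq_le hc x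

theorem boundedBelowOnOrthogonal_V₂ {c : ℝ} (hc : ∀ i, c ≤ F.σ₁ i ^ 2) :
    BoundedBelowOnOrthogonal S P F.V₂ c := fun r hSr hVr => by
  have hV := (orthonormal_toCols F.svd_right.right_orthonormal).1
  have hU := (orthonormal_toCols F.svd_right.left_orthonormal).1
  have hr : r = F.V₁ * (F.V₁ᴴ * r) := by
    rw [← Matrix.mul_assoc]
    nth_rw 1 [← Matrix.one_mul r, ← F.complete]
    rw [F.V_mul_conjTranspose, Matrix.add_mul, Matrix.add_mul, Matrix.mul_assoc F.Vs,
      F.svd_left.conjTranspose_mul_eq_zero hSr, Matrix.mul_assoc F.V₂, hVr, Matrix.mul_zero,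
      Matrix.mul_zero, zero_add, add_zero]
  rw [hr, ← Matrix.mul_assoc P, F.P_mul_V₁, Matrix.mul_assoc, frobenius_norm_mul_of_orthonormal hU,
    frobenius_norm_mul_of_orthonormal hV]
  exact le_frobenius_norm_rdiag_mul_sq hc _

theorem exists_gap : ∃ c c', c < c' ∧ BoundedAboveOnRange P (augment F.sol) c ∧
    BoundedBelowOnOrthogonal S P (augment F.sol) c' := by
  obtain ⟨c, c', hcc', hc, hc'⟩ := exists_separation (f := fun j => F.σ₂ j ^ 2)
    (g := fun i => F.σ₁ i ^ 2) fun j i =>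
      pow_lt_pow_left₀ (F.gap i j) (F.svd_right.pos (.inr j)).le two_ne_zero
  have hdet : IsUnit (-F.V₂₂⁻¹).det :=
    (isUnit_iff_isUnit_det _).1 (((isUnit_iff_isUnit_det _).2
      (isUnit_nonsing_inv_det _ F.isUnit_det)).neg)
  rw [F.augment_sol]
  exact ⟨c, c', hcc', (F.boundedAboveOnRange_V₂ hc).mul_right _,
    (F.boundedBelowOnOrthogonal_V₂ hc').mul_right hdet⟩

/-- The linear system for the derivative `ΔX` of the solution along `(ΔS, ΔP)`, in the
coordinates `[Vs, V₁]ᴴ [ΔX; 0] V₂₂`. -/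
structure IsLinearResponse (ΔS : Matrix α (ν ⊕ δ) ℂ) (ΔP : Matrix β (ν ⊕ δ) ℂ)
    (ΔX : Matrix ν δ ℂ) : Prop where
  head : rdiag F.s * (F.Vs.toRows₁ᴴ * ΔX * F.V₂₂) = F.Usᴴ * (ΔS * F.V₂)
  tail : rdiag F.σ₁ * (rdiag F.σ₁ * (F.V₁.toRows₁ᴴ * ΔX * F.V₂₂)) -
      F.V₁.toRows₁ᴴ * ΔX * F.V₂₂ * (rdiag F.σ₂ * rdiag F.σ₂) =
    F.V₁ᴴ * ((ΔP - F.T * ΔS)ᴴ * (F.U₂ * rdiag F.σ₂)) +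
      rdiag F.σ₁ * (F.U₁ᴴ * ((ΔP - F.T * ΔS) * F.V₂))

theorem V₁_mul_augment_sol : F.V₁ᴴ * augment F.sol = 0 := by
  rw [F.augment_sol, ← Matrix.mul_assoc,
    (orthonormal_toCols F.svd_right.right_orthonormal).2.1, Matrix.zero_mul]

theorem V₁_mul_S : F.V₁ᴴ * Sᴴ = 0 := by
  rw [← conjTranspose_mul, F.S_mul_V₁, conjTranspose_zero]

theorem V₁_mul_P : F.V₁ᴴ * Pᴴ = rdiag F.σ₁ * F.U₁ᴴ := by
  rw [← conjTranspose_mul, F.P_mul_V₁, conjTranspose_mul, rdiag_conjTranspose]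

theorem isLinearResponse_of_stationarityDeriv_eq_zero {ΔN : Matrix (α ⊕ β) (ν ⊕ δ) ℂ}
    {ΔX : Matrix ν δ ℂ} {ΔΛ : Matrix α δ ℂ} {ΔM : Matrix δ δ ℂ}
    (h : stationarityDeriv (fromRows S P, F.sol, F.multiplier, F.compression)
      (ΔN, ΔX, ΔΛ, ΔM) = 0) :
    F.IsLinearResponse ΔN.toRows₁ ΔN.toRows₂ ΔX := by
  set e := fromRows ΔX (0 : Matrix δ δ ℂ) * F.V₂₂ with he
  rw [stationarityDeriv, toRows₁_fromRows, toRows₂_fromRows, Prod.mk_eq_zero] at h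
  have h₁ : S * e = ΔN.toRows₁ * F.V₂ := by
    have := congrArg (· * F.V₂₂) h.1
    simpa only [he, Matrix.add_mul, Matrix.mul_assoc, F.augment_sol_mul_V₂₂, Matrix.mul_neg,
      ← sub_eq_add_neg, Matrix.zero_mul, sub_eq_zero] using this
  have h₂ : F.V₁ᴴ * (Pᴴ * (P * e - ΔN.toRows₂ * F.V₂)) =
      F.V₁ᴴ * ((ΔN.toRows₂ - F.T * ΔN.toRows₁)ᴴ * (F.U₂ * rdiag F.σ₂)) +
        F.V₁ᴴ * e * (rdiag F.σ₂ * rdiag F.σ₂) := by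
    have := congrArg (fun A => F.V₁ᴴ * (A * F.V₂₂)) h.2
    simp only [Matrix.add_mul, Matrix.sub_mul, Matrix.mul_assoc, F.augment_sol_mul_V₂₂,
      F.multiplier_mul_V₂₂, F.compression_mul_V₂₂, Matrix.mul_neg, F.P_mul_V₂, Matrix.mul_add,
      Matrix.mul_sub,
      ← Matrix.mul_assoc F.V₁ᴴ (augment _), ← Matrix.mul_assoc F.V₁ᴴ Sᴴ, F.V₁_mul_augment_sol,
      F.V₁_mul_S, Matrix.zero_mul, Matrix.mul_zero] at this
    rw [he, ← sub_eq_zero, ← this]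
    simp only [conjTranspose_sub, conjTranspose_mul, Matrix.mul_sub, Matrix.sub_mul,
      Matrix.mul_assoc]
    abel
  have h₃ : F.U₁ᴴ * (P * e) =
      F.U₁ᴴ * (F.T * (ΔN.toRows₁ * F.V₂)) + rdiag F.σ₁ * (F.V₁ᴴ * e) := by
    rw [← Matrix.mul_assoc, F.U₁_mul_P, Matrix.add_mul, ← h₁]
    simp only [Matrix.mul_assoc]
  refine ⟨?_, ?_⟩
  · rw [toRows₁_conjTranspose_mul_mul, ← he, ← Matrix.mul_assoc, ← F.svd_left.conjTranspose_mul,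
      Matrix.mul_assoc, h₁]
  · rw [← Matrix.mul_assoc, F.V₁_mul_P, Matrix.mul_assoc, Matrix.mul_sub, h₃] at h₂
    rw [toRows₁_conjTranspose_mul_mul, ← he, sub_eq_iff_eq_add, add_right_comm, ← h₂]
    simp only [Matrix.mul_sub, Matrix.sub_mul, Matrix.mul_add, Matrix.mul_assoc]
    abel

/-- Orthonormal basis of the complement of the span of `V₂`. -/
abbrev W : Matrix (ν ⊕ δ) (α ⊕ γ) ℂ := fromCols F.Vs F.V₁

theorem W_mul_add_V₂_mul : F.W * F.Wᴴ + F.V₂ * F.V₂ᴴ = 1 := by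
  rw [conjTranspose_fromCols_eq_fromRows_conjTranspose, fromCols_mul_fromRows, add_assoc,
    ← F.V_mul_conjTranspose, F.complete]

theorem toRows₁_W_conjTranspose_mul (ΔX : Matrix ν δ ℂ) :
    F.W.toRows₁ᴴ * ΔX * F.V₂₂ =
      fromRows (F.Vs.toRows₁ᴴ * ΔX * F.V₂₂) (F.V₁.toRows₁ᴴ * ΔX * F.V₂₂) := by
  have h : F.W.toRows₁ᴴ = fromRows F.Vs.toRows₁ᴴ F.V₁.toRows₁ᴴ := by
    ext (i | i) j <;> rfl
  rw [h, fromRows_mul, fromRows_mul]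

theorem leftInverse_toRows₁_W :
    fromCols (1 : Matrix ν ν ℂ) F.sol * F.W * F.W.toRows₁ᴴ = 1 := by
  have hV₂ : fromCols (1 : Matrix ν ν ℂ) F.sol * F.V₂ = 0 := by
    have h : F.V₂ = fromRows F.V.toBlocks₁₂ F.V₂₂ := (fromRows_toRows _).symm
    rw [h, fromCols_mul_fromRows, sol, Matrix.neg_mul,
      nonsing_inv_mul_cancel_right _ _ F.isUnit_det, Matrix.one_mul, add_neg_cancel]
  have h : fromCols (1 : Matrix ν ν ℂ) F.sol * F.W * F.Wᴴ = fromCols 1 F.sol := by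
    conv_rhs => rw [← Matrix.mul_one (fromCols 1 F.sol), ← F.W_mul_add_V₂_mul, Matrix.mul_add,
      ← Matrix.mul_assoc _ F.V₂, hV₂, Matrix.zero_mul, add_zero, ← Matrix.mul_assoc]
  exact congrArg toCols₁ h

theorem eq_zero_of_sq_mul_sub_mul_sq_eq_zero {Z : Matrix γ δ ℂ}
    (h : rdiag F.σ₁ * (rdiag F.σ₁ * Z) - Z * (rdiag F.σ₂ * rdiag F.σ₂) = 0) : Z = 0 := by
  ext i j
  have hij := congrFun₂ h i j
  rw [Matrix.sub_apply, rdiag_mul_apply, rdiag_mul_apply, ← Matrix.mul_assoc, mul_rdiag_apply,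
    mul_rdiag_apply] at hij
  have hlt : F.σ₂ j ^ 2 < F.σ₁ i ^ 2 :=
    pow_lt_pow_left₀ (F.gap i j) (F.svd_right.pos (.inr j)).le two_ne_zero
  have hne : ((F.σ₁ i ^ 2 - F.σ₂ j ^ 2 : ℝ) : ℂ) ≠ 0 :=
    Complex.ofReal_ne_zero.2 (sub_pos.2 hlt).ne'
  refine (mul_eq_zero.1 (Eq.trans ?_ hij)).resolve_left hne
  push_cast
  ring

theorem IsLinearResponse.eq_zero {ΔX : Matrix ν δ ℂ} (h : F.IsLinearResponse 0 0 ΔX) : ΔX = 0 := by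
  obtain ⟨head, tail⟩ := h
  simp only [Matrix.zero_mul, Matrix.mul_zero, sub_zero, conjTranspose_zero, add_zero]
    at head tail
  have hW : F.W.toRows₁ᴴ * ΔX = 0 := F.eq_zero_of_mul_V₂₂ <| by
    rw [F.toRows₁_W_conjTranspose_mul, eq_zero_of_rdiag_mul_eq_zero F.svd_left.pos head,
      F.eq_zero_of_sq_mul_sub_mul_sq_eq_zero tail, fromRows_zero]
  rw [← Matrix.one_mul ΔX, ← F.leftInverse_toRows₁_W, Matrix.mul_assoc, hW, Matrix.mul_zero]

theorem eq_zero_of_stationarityDeriv_eq_zero {ΔX : Matrix ν δ ℂ} {ΔΛ : Matrix α δ ℂ}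
    {ΔM : Matrix δ δ ℂ}
    (h : stationarityDeriv (fromRows S P, F.sol, F.multiplier, F.compression)
      (0, ΔX, ΔΛ, ΔM) = 0) : (ΔX, ΔΛ, ΔM) = 0 := by
  obtain rfl : ΔX = 0 := (F.isLinearResponse_of_stationarityDeriv_eq_zero h).eq_zero
  have h₂ : Sᴴ * ΔΛ + augment F.sol * ΔM = 0 := by
    have h₁ : (0 : Matrix (α ⊕ β) (ν ⊕ δ) ℂ).toRows₁ = 0 := rfl
    have h₂ : (0 : Matrix (α ⊕ β) (ν ⊕ δ) ℂ).toRows₂ = 0 := rfl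
    simpa [stationarityDeriv, h₁, h₂, ← neg_add, -neg_add_rev] using congrArg Prod.snd h
  obtain rfl : ΔM = 0 := by
    have hV₂Y : F.V₂ᴴ * augment F.sol = -F.V₂₂⁻¹ := by
      rw [F.augment_sol, ← Matrix.mul_assoc,
        (orthonormal_toCols F.svd_right.right_orthonormal).2.2, Matrix.one_mul]
    have hV₂S : F.V₂ᴴ * Sᴴ = 0 := by rw [← conjTranspose_mul, F.S_mul_V₂, conjTranspose_zero]
    have hM : F.V₂₂⁻¹ * ΔM = 0 := by
      simpa [Matrix.mul_add, ← Matrix.mul_assoc, hV₂Y, hV₂S] using congrArg (F.V₂ᴴ * ·) h₂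
    rw [← mul_nonsing_inv_cancel_left _ ΔM F.isUnit_det, hM, Matrix.mul_zero]
  obtain rfl : ΔΛ = 0 := by
    have hVsS : F.Vsᴴ * Sᴴ = rdiag F.s * F.Usᴴ := by
      rw [← conjTranspose_mul, F.svd_left.mul_right, conjTranspose_mul, rdiag_conjTranspose]
    have hUs : F.Usᴴ * ΔΛ = 0 := eq_zero_of_rdiag_mul_eq_zero F.svd_left.pos <| by
      simpa [← Matrix.mul_assoc, hVsS] using congrArg (F.Vsᴴ * ·) h₂
    rw [← Matrix.one_mul ΔΛ, ← mul_eq_one_comm.1 F.svd_left.left_orthonormal, Matrix.mul_assoc,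
      hUs, Matrix.mul_zero]
  rfl

theorem exists_solution_map :
    ∃ (φ : Matrix (α ⊕ β) (ν ⊕ δ) ℂ → Matrix ν δ ℂ)
      (φ' : Matrix (α ⊕ β) (ν ⊕ δ) ℂ →L[ℝ] Matrix ν δ ℂ),
      HasFDerivAt φ φ' (fromRows S P) ∧
      (∀ᶠ N in 𝓝 (fromRows S P), IsTLSSolution N.toRows₁ N.toRows₂ (φ N) ∧
        ∀ X, IsTLSSolution N.toRows₁ N.toRows₂ X → X = φ N) ∧
      ∀ ΔN, F.IsLinearResponse ΔN.toRows₁ ΔN.toRows₂ (φ' ΔN) := by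
  obtain ⟨L, hL, hLv⟩ := exists_hasStrictFDerivAt_stationarity
    (fromRows S P, F.sol, F.multiplier, F.compression)
  have hdim : Module.finrank ℝ (Matrix ν δ ℂ × Matrix α δ ℂ × Matrix δ δ ℂ) =
      Module.finrank ℝ (Matrix α δ ℂ × Matrix (ν ⊕ δ) δ ℂ) := by
    simp only [Module.finrank_prod, Module.finrank_matrix, Fintype.card_sum]
    ring
  obtain ⟨ψ, ψ', hψ, hψ_tendsto, hψ_zero, hLψ⟩ := exists_implicit_solution hL
    (fun u hu => F.eq_zero_of_stationarityDeriv_eq_zero ((hLv (0, u)).symm.trans hu)) hdim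
    F.stationarity_sol
  refine ⟨fun N => (ψ N).1, (ContinuousLinearMap.fst ℝ _ _).comp ψ', hψ.fst, ?_, fun ΔN =>
    F.isLinearResponse_of_stationarityDeriv_eq_zero ((hLv (ΔN, ψ' ΔN)).symm.trans (hLψ ΔN))⟩
  obtain ⟨c, c', hcc', habove, hbelow⟩ := F.exists_gap
  obtain ⟨a, hca, hac'⟩ := exists_between hcc'
  obtain ⟨b, hab, hbc'⟩ := exists_between hac'
  obtain ⟨_, haugment, -⟩ := exists_hasStrictFDerivAt_augment (hasStrictFDerivAt_id (𝕜 := ℝ) F.sol)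
  have hY : Tendsto (fun N => augment (ψ N).1) (𝓝 (fromRows S P)) (𝓝 (augment F.sol)) :=
    haugment.continuousAt.tendsto.comp ((continuous_fst.tendsto _).comp hψ_tendsto)
  have hP : Tendsto toRows₂ (𝓝 (fromRows S P)) (𝓝 P) :=
    (continuous_id.matrix_submatrix Sum.inr id).tendsto _
  have hS : Tendsto toRows₁ (𝓝 (fromRows S P)) (𝓝 S) :=
    (continuous_id.matrix_submatrix Sum.inl id).tendsto _
  filter_upwards [hψ_zero,
    (hP.prodMk_nhds hY).eventually
      (habove.eventually (fromCols_zero_neg_one_mul_augment F.sol) hca),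
    (hS.prodMk_nhds (hP.prodMk_nhds hY)).eventually (hbelow.eventually hbc')]
    with N hzero hNabove hNbelow
  exact existsUnique_isTLSSolution hab (congrArg Prod.fst hzero)
    (sub_eq_zero.1 (congrArg Prod.snd hzero)) hNabove hNbelow

end ConstrainedSVD

/-! ### The formula for the derivative -/

section Vectorization

theorem kronecker_mulVec_vec_transpose {α β γ κ : Type*} [Fintype β] [Fintype κ]
    (M : Matrix α β ℂ) (N : Matrix γ κ ℂ)
    (Z : Matrix β κ ℂ) : (M ⊗ₖ N) *ᵥ vec Zᵀ = vec (M * Z * Nᵀ)ᵀ := by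
  rw [kronecker_mulVec_vec, transpose_mul, transpose_mul, transpose_transpose, Matrix.mul_assoc]

variable {α β : Type*} [Fintype α] [Fintype β]

theorem permPi_mulVec_vec_transpose [DecidableEq α] [DecidableEq β] (Z : Matrix β α ℂ) :
    permPi α β *ᵥ vec Zᵀ = vec Z := by
  simp only [permPi, sum_mulVec, kronecker_mulVec_vec, transpose_single, single_mul_mul_single,
    transpose_apply, one_mul, mul_one, ← vec_sum]
  rw [Finset.sum_comm, ← matrix_eq_sum_single]

theorem norm_toLp_vec (A : Matrix α β ℂ) : ‖WithLp.toLp 2 (vec A)‖ = ‖A‖ := by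
  rw [← sq_eq_sq₀ (norm_nonneg _) (norm_nonneg _), EuclideanSpace.norm_sq_eq,
    Fintype.sum_prod_type_right, frobenius_norm_sq]
  rfl

theorem norm_toLp_sumElim_sq (u : α → ℂ) (v : β → ℂ) :
    ‖WithLp.toLp 2 (Sum.elim u v)‖ ^ 2 = ‖WithLp.toLp 2 u‖ ^ 2 + ‖WithLp.toLp 2 v‖ ^ 2 := by
  simp only [EuclideanSpace.norm_sq_eq, Fintype.sum_sum_type, Sum.elim_inl, Sum.elim_inr]

theorem sqInv_conjTranspose_of_leftInverse [DecidableEq α] (e : β ≃ α)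
    {M K : Matrix α β ℂ} (h : K * Mᴴ = 1) : (sqInv e M)ᴴ = K := by
  have hMK : M * Kᴴ = 1 := by simpa using congrArg conjTranspose h
  have hinv : M.submatrix id e.symm * Kᴴ.submatrix e.symm id = 1 := by
    rw [submatrix_mul_equiv M Kᴴ id e.symm id, hMK, submatrix_id_id]
  rw [sqInv, inv_eq_right_inv hinv]
  ext i j
  simp

end Vectorization

theorem Qc_conjTranspose_mul {m p : ℕ} {κ : Type*} (T : Matrix (Fin m ⊕ Fin m) (Fin p ⊕ Fin p) ℂ)
    (Δ : Matrix ((Fin p ⊕ Fin p) ⊕ (Fin m ⊕ Fin m)) κ ℂ) :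
    (Qc T)ᴴ * Δ = Δ.toRows₂ - T * Δ.toRows₁ := by
  conv_lhs => rw [← fromRows_toRows Δ]
  rw [Qc, conjTranspose_fromRows_eq_fromCols_conjTranspose, fromCols_mul_fromRows,
    conjTranspose_neg, conjTranspose_conjTranspose, conjTranspose_one, Matrix.neg_mul,
    Matrix.one_mul, neg_add_eq_sub]

namespace ConstrainedSVD

section Coordinates

variable {α β γ ν δ : Type*} [Fintype α] [DecidableEq α] [Fintype β] [Fintype γ] [DecidableEq γ]
  [Fintype ν] [DecidableEq ν] [Fintype δ] [DecidableEq δ]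
  {S : Matrix α (ν ⊕ δ) ℂ} {P : Matrix β (ν ⊕ δ) ℂ} (F : ConstrainedSVD S P γ)

/-- Orthonormal basis of the left singular subspaces of `S` and of `P` for the singular values `s`
and `σ₁`. -/
abbrev Ω : Matrix (α ⊕ β) (α ⊕ γ) ℂ := fromBlocks F.Us 0 0 F.U₁

/-- The components of a perturbation `Δ` of `[S; P]` that affect the solution to first order,
namely the entries of `(Δ W)ᴴ` and of `Ωᴴ Δ V₂`, listed by rows. -/
def coords (Δ : Matrix (α ⊕ β) (ν ⊕ δ) ℂ) : ((α ⊕ γ) × (α ⊕ β)) ⊕ ((α ⊕ γ) × δ) → ℂ :=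
  Sum.elim (vec (Δ * F.W)ᴴᵀ) (vec (F.Ωᴴ * (Δ * F.V₂))ᵀ)

theorem Ω_orthonormal : F.Ωᴴ * F.Ω = 1 := by
  rw [fromBlocks_conjTranspose, fromBlocks_multiply, ← fromBlocks_one, F.svd_left.left_orthonormal,
    (orthonormal_toCols F.svd_right.left_orthonormal).1]
  simp only [conjTranspose_zero, Matrix.mul_zero, Matrix.zero_mul, add_zero, zero_add]

theorem Ω_conjTranspose_mul {κ : Type*} (Δ : Matrix (α ⊕ β) κ ℂ) :
    F.Ωᴴ * Δ = fromRows (F.Usᴴ * Δ.toRows₁) (F.U₁ᴴ * Δ.toRows₂) := by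
  conv_lhs => rw [← fromRows_toRows Δ]
  rw [fromBlocks_conjTranspose, fromBlocks_mul_fromRows]
  simp only [conjTranspose_zero, Matrix.zero_mul, add_zero, zero_add]

theorem Vs_mul_V₁ : F.Vsᴴ * F.V₁ = 0 := congrArg toCols₁ F.Vs_mul_V

theorem Vs_mul_V₂ : F.Vsᴴ * F.V₂ = 0 := congrArg toCols₂ F.Vs_mul_V

theorem W_orthonormal : F.Wᴴ * F.W = 1 := by
  have hVs : F.V₁ᴴ * F.Vs = 0 := by simpa using congrArg conjTranspose F.Vs_mul_V₁
  rw [conjTranspose_fromCols_eq_fromRows_conjTranspose, fromRows_mul_fromCols,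
    F.svd_left.right_orthonormal, F.Vs_mul_V₁, hVs,
    (orthonormal_toCols F.svd_right.right_orthonormal).1, fromBlocks_one]

theorem W_mul_V₂ : F.Wᴴ * F.V₂ = 0 := by
  rw [conjTranspose_fromCols_eq_fromRows_conjTranspose, fromRows_mul, F.Vs_mul_V₂,
    (orthonormal_toCols F.svd_right.right_orthonormal).2.1, fromRows_zero]

theorem norm_sq_eq (Δ : Matrix (α ⊕ β) (ν ⊕ δ) ℂ) :
    ‖Δ‖ ^ 2 = ‖Δ * F.W‖ ^ 2 + ‖Δ * F.V₂‖ ^ 2 := by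
  have hproj : Δ - Δ * F.W * F.Wᴴ = Δ * F.V₂ * F.V₂ᴴ := by
    rw [sub_eq_iff_eq_add', Matrix.mul_assoc, Matrix.mul_assoc, ← Matrix.mul_add,
      F.W_mul_add_V₂_mul, Matrix.mul_one]
  rw [frobenius_norm_sq_eq_add_of_orthonormal' F.W_orthonormal, hproj,
    frobenius_norm_mul_conjTranspose_of_orthonormal
      (orthonormal_toCols F.svd_right.right_orthonormal).2.2]

theorem norm_coords_sq (Δ : Matrix (α ⊕ β) (ν ⊕ δ) ℂ) :
    ‖WithLp.toLp 2 (F.coords Δ)‖ ^ 2 = ‖Δ * F.W‖ ^ 2 + ‖F.Ωᴴ * (Δ * F.V₂)‖ ^ 2 := by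
  rw [coords, norm_toLp_sumElim_sq, norm_toLp_vec, norm_toLp_vec, frobenius_norm_transpose,
    frobenius_norm_transpose, frobenius_norm_conjTranspose]

theorem norm_coords_le (Δ : Matrix (α ⊕ β) (ν ⊕ δ) ℂ) : ‖WithLp.toLp 2 (F.coords Δ)‖ ≤ ‖Δ‖ := by
  rw [← sq_le_sq₀ (norm_nonneg _) (norm_nonneg _), F.norm_coords_sq, F.norm_sq_eq]
  gcongr
  exact frobenius_norm_conjTranspose_mul_le_of_orthonormal F.Ω_orthonormal _

theorem exists_coords_eq (x : ((α ⊕ γ) × (α ⊕ β)) ⊕ ((α ⊕ γ) × δ) → ℂ) :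
    ∃ Δ, F.coords Δ = x ∧ ‖Δ‖ = ‖WithLp.toLp 2 x‖ := by
  obtain ⟨A, hA⟩ := vec_bijective.2 (x ∘ Sum.inl)
  obtain ⟨B, hB⟩ := vec_bijective.2 (x ∘ Sum.inr)
  have hV₂ := (orthonormal_toCols F.svd_right.right_orthonormal).2.2
  have hV₂W : F.V₂ᴴ * F.W = 0 := by simpa using congrArg conjTranspose F.W_mul_V₂
  set Δ := Aᵀᴴ * F.Wᴴ + F.Ω * Bᵀ * F.V₂ᴴ with hΔ
  have hΔW : Δ * F.W = Aᵀᴴ := by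
    rw [hΔ, Matrix.add_mul, Matrix.mul_assoc, F.W_orthonormal, Matrix.mul_assoc (F.Ω * _), hV₂W,
      Matrix.mul_one, Matrix.mul_zero, add_zero]
  have hΔV₂ : Δ * F.V₂ = F.Ω * Bᵀ := by
    rw [hΔ, Matrix.add_mul, Matrix.mul_assoc, F.W_mul_V₂, Matrix.mul_assoc (F.Ω * _), hV₂,
      Matrix.mul_one, Matrix.mul_zero, zero_add]
  have hx : F.coords Δ = x := by
    rw [coords, hΔW, hΔV₂, ← Matrix.mul_assoc, F.Ω_orthonormal, Matrix.one_mul,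
      conjTranspose_conjTranspose, transpose_transpose, transpose_transpose, hA, hB,
      Sum.elim_comp_inl_inr]
  refine ⟨Δ, hx, ?_⟩
  rw [← sq_eq_sq₀ (norm_nonneg _) (norm_nonneg _), ← hx, F.norm_coords_sq, F.norm_sq_eq, hΔV₂,
    ← Matrix.mul_assoc, F.Ω_orthonormal, Matrix.one_mul,
    frobenius_norm_mul_of_orthonormal F.Ω_orthonormal]

end Coordinates

section Formula

variable {m n d p q : ℕ} {S : Matrix (Fin p ⊕ Fin p) (Fin n ⊕ Fin d) ℂ}
  {P : Matrix (Fin m ⊕ Fin m) (Fin n ⊕ Fin d) ℂ} (F : ConstrainedSVD S P (Fin q))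

theorem Zc_mulVec_coords (Δ : Matrix ((Fin p ⊕ Fin p) ⊕ (Fin m ⊕ Fin m)) (Fin n ⊕ Fin d) ℂ) :
    Zc F.T F.Us F.U₁ F.U₂ *ᵥ F.coords Δ =
      Sum.elim
        (vec (fromRows (0 : Matrix (Fin p ⊕ Fin p) (Fin d) ℂ)
          (F.V₁ᴴ * ((Δ.toRows₂ - F.T * Δ.toRows₁)ᴴ * F.U₂)))ᵀ)
        (vec (fromRows (F.Usᴴ * (Δ.toRows₁ * F.V₂))
          (F.U₁ᴴ * ((Δ.toRows₂ - F.T * Δ.toRows₁) * F.V₂)))ᵀ) := by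
  have hupper : tailProj p q * (Δ * F.W)ᴴ * (F.U₂ᵀ * (Qc F.T)ᵀ)ᵀ =
      fromRows 0 (F.V₁ᴴ * ((Δ.toRows₂ - F.T * Δ.toRows₁)ᴴ * F.U₂)) := by
    rw [transpose_mul, transpose_transpose, transpose_transpose, Matrix.mul_assoc,
      conjTranspose_mul, Matrix.mul_assoc, ← Matrix.mul_assoc Δᴴ, ← conjTranspose_conjTranspose
      (Qc F.T), ← conjTranspose_mul, Qc_conjTranspose_mul,
      conjTranspose_fromCols_eq_fromRows_conjTranspose, fromRows_mul, tailProj,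
      fromBlocks_mul_fromRows]
    simp only [Matrix.zero_mul, Matrix.one_mul, add_zero, zero_add]
  have hlower : (fromBlocks 1 0 (-(F.U₁ᴴ * F.T * F.Us)) 1 : Matrix (Idx p q) (Idx p q) ℂ) *
      (F.Ωᴴ * (Δ * F.V₂)) = fromRows (F.Usᴴ * (Δ.toRows₁ * F.V₂))
        (F.U₁ᴴ * ((Δ.toRows₂ - F.T * Δ.toRows₁) * F.V₂)) := by
    have hUs : F.Us * (F.Usᴴ * (Δ.toRows₁ * F.V₂)) = Δ.toRows₁ * F.V₂ := by
      rw [← Matrix.mul_assoc, mul_eq_one_comm.1 F.svd_left.left_orthonormal, Matrix.one_mul]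
    have hΔ₁ : (Δ * F.V₂).toRows₁ = Δ.toRows₁ * F.V₂ := rfl
    have hΔ₂ : (Δ * F.V₂).toRows₂ = Δ.toRows₂ * F.V₂ := rfl
    rw [F.Ω_conjTranspose_mul, fromBlocks_mul_fromRows]
    simp only [hΔ₁, hΔ₂, Matrix.one_mul, Matrix.zero_mul, add_zero,
      Matrix.neg_mul, Matrix.mul_assoc, Matrix.sub_mul, Matrix.mul_sub, hUs, neg_add_eq_sub]
  rw [Zc, coords, fromBlocks_mulVec]
  simp only [Sum.elim_comp_inl, Sum.elim_comp_inr, zero_mulVec, add_zero, zero_add,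
    kronecker_mulVec_vec_transpose, hupper, hlower, transpose_one, Matrix.mul_one]

theorem coefficient_mulVec_vec (Z : Matrix (Fin p ⊕ Fin p) (Fin d) ℂ)
    (Z' : Matrix (Fin q) (Fin d) ℂ) :
    ((Sc F.s F.σ₁ ^ 2) ⊗ₖ (1 : Matrix (Fin d) (Fin d) ℂ) -
        tailProj p q ⊗ₖ ((rdiag F.σ₂)ᴴ * rdiag F.σ₂)) *ᵥ vec (fromRows Z Z')ᵀ =
      vec (fromRows (rdiag F.s * (rdiag F.s * Z))
        (rdiag F.σ₁ * (rdiag F.σ₁ * Z') - Z' * (rdiag F.σ₂ * rdiag F.σ₂)))ᵀ := by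
  have hT : (rdiag F.σ₂ * rdiag F.σ₂)ᵀ = rdiag F.σ₂ * rdiag F.σ₂ := by simp [rdiag]
  rw [sub_mulVec, kronecker_mulVec_vec_transpose, kronecker_mulVec_vec_transpose, ← vec_sub,
    ← transpose_sub, rdiag_conjTranspose, hT, transpose_one, Matrix.mul_one, sq, Matrix.mul_assoc,
    Sc, tailProj, fromBlocks_mul_fromRows, fromBlocks_mul_fromRows, fromBlocks_mul_fromRows,
    fromRows_mul]
  congr 2
  ext (i | i) j <;> simp

theorem isUnit_det_coefficient :
    IsUnit ((Sc F.s F.σ₁ ^ 2) ⊗ₖ (1 : Matrix (Fin d) (Fin d) ℂ) -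
      tailProj p q ⊗ₖ ((rdiag F.σ₂)ᴴ * rdiag F.σ₂)).det := by
  rw [← isUnit_iff_isUnit_det, ← mulVec_injective_iff_isUnit]
  refine (injective_iff_map_eq_zero (mulVecLin _)).2 fun v hv => ?_
  obtain ⟨Z, rfl⟩ := vec_bijective.2 v
  rw [← transpose_transpose Z, ← fromRows_toRows Zᵀ] at hv ⊢
  rw [mulVecLin_apply, F.coefficient_mulVec_vec, vec_eq_zero_iff, transpose_eq_zero,
    ← fromRows_zero, fromRows_inj.eq_iff] at hv
  have hhead := eq_zero_of_rdiag_mul_eq_zero F.svd_left.pos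
    (eq_zero_of_rdiag_mul_eq_zero F.svd_left.pos hv.1)
  rw [hhead, F.eq_zero_of_sq_mul_sub_mul_sq_eq_zero hv.2, fromRows_zero, transpose_zero, vec_zero]

variable {F}
  {Δ : Matrix ((Fin p ⊕ Fin p) ⊕ (Fin m ⊕ Fin m)) (Fin n ⊕ Fin d) ℂ} {ΔX : Matrix (Fin n) (Fin d) ℂ}

theorem IsLinearResponse.Gc_mulVec (h : F.IsLinearResponse Δ.toRows₁ Δ.toRows₂ ΔX) :
    Gc (Sc F.s F.σ₁) (rdiag F.σ₂) *ᵥ (Zc F.T F.Us F.U₁ F.U₂ *ᵥ F.coords Δ) =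
      vec (F.W.toRows₁ᴴ * ΔX * F.V₂₂)ᵀ := by
  have hT : (rdiag F.σ₂)ᵀ = rdiag F.σ₂ := by simp [rdiag]
  have hrhs : fromCols ((1 : Matrix (Idx p q) (Idx p q) ℂ) ⊗ₖ (rdiag F.σ₂)ᴴ)
      (Sc F.s F.σ₁ ⊗ₖ (1 : Matrix (Fin d) (Fin d) ℂ)) *ᵥ
        (Zc F.T F.Us F.U₁ F.U₂ *ᵥ F.coords Δ) =
      ((Sc F.s F.σ₁ ^ 2) ⊗ₖ (1 : Matrix (Fin d) (Fin d) ℂ) -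
        tailProj p q ⊗ₖ ((rdiag F.σ₂)ᴴ * rdiag F.σ₂)) *ᵥ vec (F.W.toRows₁ᴴ * ΔX * F.V₂₂)ᵀ := by
    have hcoeff := F.coefficient_mulVec_vec (F.Vs.toRows₁ᴴ * ΔX * F.V₂₂)
      (F.V₁.toRows₁ᴴ * ΔX * F.V₂₂)
    rw [F.toRows₁_W_conjTranspose_mul, hcoeff, F.Zc_mulVec_coords, fromCols_mulVec_sumElim,
      kronecker_mulVec_vec_transpose, kronecker_mulVec_vec_transpose, ← vec_add, ← transpose_add,
      rdiag_conjTranspose, hT, h.head, h.tail, transpose_one, Matrix.mul_one, Matrix.one_mul, Sc,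
      fromBlocks_mul_fromRows, fromRows_mul]
    congr 2
    ext (i | i) j <;> simp [Matrix.mul_assoc]
  rw [Gc, ← mulVec_mulVec, hrhs, mulVec_mulVec, nonsing_inv_mul _ F.isUnit_det_coefficient,
    one_mulVec]

theorem IsLinearResponse.Hc_mul_Gc_mul_Zc_mulVec (hn : n = 2 * p + q)
    (h : F.IsLinearResponse Δ.toRows₁ Δ.toRows₂ ΔX) :
    (Hc hn F.V₂₂ (W1c F.Vs F.V₁) * Gc (Sc F.s F.σ₁) (rdiag F.σ₂) * Zc F.T F.Us F.U₁ F.U₂) *ᵥ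
      F.coords Δ = vec ΔX := by
  rw [Matrix.mul_assoc, ← mulVec_mulVec, ← mulVec_mulVec, h.Gc_mulVec, Hc, ← mulVec_mulVec,
    permPi_mulVec_vec_transpose, kronecker_mulVec_vec, W1c,
    sqInv_conjTranspose_of_leftInverse _ F.leftInverse_toRows₁_W, transpose_transpose,
    ← Matrix.mul_assoc, mul_nonsing_inv_cancel_right _ _ F.isUnit_det, ← Matrix.mul_assoc,
    F.leftInverse_toRows₁_W, Matrix.one_mul]

theorem isLeast_specNorm_Hc_mul_Gc_mul_Zc (hn : n = 2 * p + q)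
    {L : Matrix ((Fin p ⊕ Fin p) ⊕ (Fin m ⊕ Fin m)) (Fin n ⊕ Fin d) ℂ → Matrix (Fin n) (Fin d) ℂ}
    (hL : ∀ Δ, F.IsLinearResponse Δ.toRows₁ Δ.toRows₂ (L Δ)) :
    IsLeast {c | 0 ≤ c ∧ ∀ Δ, ‖L Δ‖ ≤ c * ‖Δ‖}
      (specNorm (Hc hn F.V₂₂ (W1c F.Vs F.V₁) * Gc (Sc F.s F.σ₁) (rdiag F.σ₂) *
        Zc F.T F.Us F.U₁ F.U₂)) :=
  isLeast_specNorm (fun Δ => by rw [(hL Δ).Hc_mul_Gc_mul_Zc_mulVec hn, norm_toLp_vec])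
    F.norm_coords_le F.exists_coords_eq

end Formula

end ConstrainedSVD

/-! ### Relative condition numbers of differentiable maps -/

section Condition

theorem eventually_mul_lt {δ : ℝ} (hδ : 0 < δ) (ρ : ℝ) : ∀ᶠ ε in 𝓝[>] (0 : ℝ), ε * ρ < δ := by
  have hcont : Continuous fun ε : ℝ => ε * ρ := by fun_prop
  exact ((hcont.tendsto 0).mono_left nhdsWithin_le_nhds).eventually_lt_const (by simpa using hδ)

variable {E F : Type*} [NormedAddCommGroup E] [NormedSpace ℝ E] [NormedAddCommGroup F]
  [NormedSpace ℝ F] {φ : E → F} {L : E →L[ℝ] F} {a : E} {ρ : ℝ}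

theorem exists_lt_norm_apply_of_lt_norm (L : E →L[ℝ] F) {b t : ℝ} (hb : 0 ≤ b) (ht : 0 ≤ t)
    (h : b < ‖L‖ * t) : ∃ v, ‖v‖ ≤ 1 ∧ b < ‖L v‖ * t := by
  have ht' : 0 < t := ht.lt_of_ne fun h₀ => by
    rw [← h₀, mul_zero] at h
    exact hb.not_gt h
  by_contra! hle
  refine h.not_ge ((le_div_iff₀ ht').1 (L.opNorm_le_of_unit_norm (by positivity) fun v hv => ?_))
  exact (le_div_iff₀ ht').2 (hle v hv.le)

theorem tendsto_norm_slope (hφ : HasFDerivAt φ L a) (v : E) :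
    Tendsto (fun ε : ℝ => ‖φ (a + ε • v) - φ a‖ / ε) (𝓝[>] 0) (𝓝 ‖L v‖) := by
  have hline : HasDerivAt (fun ε : ℝ => φ (a + ε • v)) (L v) 0 := hφ.hasLineDerivAt v
  refine hline.tendsto_slope_zero_right.norm.congr' ?_
  filter_upwards [self_mem_nhdsWithin] with ε hε
  rw [norm_smul, zero_add, zero_smul, add_zero, norm_inv, Real.norm_of_nonneg (le_of_lt hε),
    inv_mul_eq_div]

theorem eventually_norm_sub_le (hφ : HasFDerivAt φ L a) {b : ℝ}
    (hb : ‖L‖ < b) : ∀ᶠ ε in 𝓝[>] (0 : ℝ), ∀ Δ, ‖Δ‖ ≤ ε * ρ → ‖φ (a + Δ) - φ a‖ ≤ b * (ε * ρ) := by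
  have hlittleO := (hasFDerivAt_iff_isLittleO_nhds_zero.1 hφ).def (sub_pos.2 hb)
  obtain ⟨δ, hδ, hball⟩ := Metric.eventually_nhds_iff.1 hlittleO
  filter_upwards [eventually_mul_lt hδ ρ] with ε hε Δ hΔ
  calc ‖φ (a + Δ) - φ a‖ = ‖L Δ + (φ (a + Δ) - φ a - L Δ)‖ := by congr 1; abel
    _ ≤ ‖L‖ * ‖Δ‖ + (b - ‖L‖) * ‖Δ‖ := (norm_add_le _ _).trans
        (add_le_add (L.le_opNorm Δ) (hball (by simpa using hΔ.trans_lt hε)))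
    _ = b * ‖Δ‖ := by ring
    _ ≤ b * (ε * ρ) := by gcongr; exact (norm_nonneg L).trans hb.le

/-- Supremum of the relative changes `‖φ (a + Δ) - φ a‖ / (ε c)` over all perturbations with
`‖Δ‖ ≤ ε ρ`, in `[0, ∞]`. -/
def mapRelChangeSup (φ : E → F) (a : E) (ρ c ε : ℝ) : ℝ≥0∞ :=
  ⨆ (Δ : E) (_ : ‖Δ‖ ≤ ε * ρ), ENNReal.ofReal (‖φ (a + Δ) - φ a‖ / (ε * c))

theorem eventually_lt_mapRelChangeSup (hφ : HasFDerivAt φ L a) (hρ : 0 ≤ ρ) {c : ℝ}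
    (hc : 0 < c) {b : ℝ≥0∞} (hb : b < ENNReal.ofReal (‖L‖ * (ρ / c))) :
    ∀ᶠ ε in 𝓝[>] 0, b < mapRelChangeSup φ a ρ c ε := by
  have hbt : b ≠ ⊤ := (hb.trans ENNReal.ofReal_lt_top).ne
  obtain ⟨v, hv, hbv⟩ := exists_lt_norm_apply_of_lt_norm L ENNReal.toReal_nonneg (by positivity)
    ((ENNReal.lt_ofReal_iff_toReal_lt hbt).1 hb)
  have hlim := (tendsto_norm_slope hφ (ρ • v)).div_const c
  rw [map_smul, norm_smul, Real.norm_of_nonneg hρ, mul_comm ρ, mul_div_assoc] at hlim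
  filter_upwards [hlim.eventually_const_lt hbv, self_mem_nhdsWithin] with ε hlt hε
  have hε₀ : 0 ≤ ε := le_of_lt hε
  have hΔ : ‖ε • (ρ • v)‖ ≤ ε * ρ := by
    rw [norm_smul, norm_smul, Real.norm_of_nonneg hρ, Real.norm_of_nonneg hε₀]
    exact mul_le_mul_of_nonneg_left (mul_le_of_le_one_right hρ hv) hε₀
  rw [div_div] at hlt
  exact ((ENNReal.lt_ofReal_iff_toReal_lt hbt).2 hlt).trans_le (le_iSup₂_of_le _ hΔ le_rfl)

theorem eventually_mapRelChangeSup_lt (hφ : HasFDerivAt φ L a) {c : ℝ} (hc : 0 < c)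
    {b : ℝ≥0∞} (hb : ENNReal.ofReal (‖L‖ * (ρ / c)) < b) :
    ∀ᶠ ε in 𝓝[>] 0, mapRelChangeSup φ a ρ c ε < b := by
  have hcont : Continuous fun x : ℝ => ENNReal.ofReal (x * (ρ / c)) :=
    ENNReal.continuous_ofReal.comp (by fun_prop)
  obtain ⟨x, hx, hLx⟩ := (((hcont.tendsto ‖L‖).mono_left nhdsWithin_le_nhds).eventually_lt_const hb
    |>.and (self_mem_nhdsWithin (s := Set.Ioi ‖L‖))).exists
  filter_upwards [eventually_norm_sub_le hφ hLx, self_mem_nhdsWithin] with ε hle hε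
  have hε₀ : 0 < ε := hε
  refine (iSup₂_le fun Δ hΔ => ENNReal.ofReal_le_ofReal ?_).trans_lt hx
  calc ‖φ (a + Δ) - φ a‖ / (ε * c) ≤ x * (ε * ρ) / (ε * c) := by gcongr; exact hle Δ hΔ
    _ = x * (ρ / c) := by field_simp

theorem tendsto_mapRelChangeSup (hφ : HasFDerivAt φ L a) {κ : ℝ}
    (hκ : IsLeast {b | 0 ≤ b ∧ ∀ v, ‖L v‖ ≤ b * ‖v‖} κ) (hρ : 0 ≤ ρ) {c : ℝ} (hc : 0 < c) :
    Tendsto (mapRelChangeSup φ a ρ c) (𝓝[>] 0) (𝓝 (ENNReal.ofReal (κ * (ρ / c)))) := by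
  obtain rfl := hκ.unique L.isLeast_opNorm
  exact tendsto_order.2 ⟨fun _ => eventually_lt_mapRelChangeSup hφ hρ hc,
    fun _ => eventually_mapRelChangeSup_lt hφ hc⟩

end Condition

/-! ### Reduction to complex matrices -/

section ReducedBiquaternions

variable {α β γ : Type*}

theorem cCol_bijective : Function.Bijective (cCol : Matrix α β RB → Matrix (α ⊕ α) β ℂ) := by
  refine ⟨fun M N h => ?_, fun M => ⟨of fun i j => ⟨M (.inl i) j, M (.inr i) j⟩, ?_⟩⟩
  · ext i j
    · exact congrFun₂ h (.inl i) j
    · exact congrFun₂ h (.inr i) j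
  · ext (i | i) j <;> rfl

theorem cCol_add (M N : Matrix α β RB) : cCol (M + N) = cCol M + cCol N := by
  ext (i | i) j <;> rfl

theorem cCol_fromCols (M : Matrix α β RB) (N : Matrix α γ RB) :
    cCol (fromCols M N) = fromCols (cCol M) (cCol N) := by
  ext (i | i) (j | j) <;> rfl

theorem cCol_mul_ofComplex [Fintype β] (M : Matrix α β RB) (X : Matrix β γ ℂ) :
    cCol (M * ofComplex X) = cCol M * X := by
  have hre (f : β → RB) : (∑ k, f k).re = ∑ k, (f k).re := map_sum (QuadraticAlgebra.reₗ _ _) f _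
  have him (f : β → RB) : (∑ k, f k).im = ∑ k, (f k).im := map_sum (QuadraticAlgebra.imₗ _ _) f _
  ext (i | i) j
  · simp [cCol, mul_apply, hre, ofComplex]
  · simp [cCol, mul_apply, him, ofComplex]

theorem rbFrob_eq_norm_cCol [Fintype α] [Fintype β] (M : Matrix α β RB) :
    rbFrob M = ‖cCol M‖ := by
  rw [rbFrob, ← Real.sqrt_sq (norm_nonneg (cCol M)), frobenius_norm_sq, Fintype.sum_sum_type,
    ← Finset.sum_add_distrib]
  simp only [Finset.sum_add_distrib]
  rfl

end ReducedBiquaternions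

section Reduction

variable {m n d p : ℕ} (A : Matrix (Fin m) (Fin n) RB) (B : Matrix (Fin m) (Fin d) RB)
  (C : Matrix (Fin p) (Fin n) RB) (D : Matrix (Fin p) (Fin d) RB)

theorem mul_ofComplex_eq_iff (X : Matrix (Fin n) (Fin d) ℂ) :
    A * ofComplex X = B ↔ cCol (fromCols A B) * augment X = 0 := by
  rw [cCol_fromCols, augment, fromCols_mul_fromRows, Matrix.mul_neg, Matrix.mul_one,
    ← sub_eq_add_neg, sub_eq_zero, ← cCol_mul_ofComplex, cCol_bijective.1.eq_iff]

theorem isFeasible_iff_isTLSFeasible (X : Matrix (Fin n) (Fin d) ℂ)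
    (G : Matrix (Fin m) (Fin n) RB) (H : Matrix (Fin m) (Fin d) RB) :
    IsFeasible A B C D X G H ↔
      IsTLSFeasible (cCol (fromCols C D)) (cCol (fromCols A B)) X (cCol (fromCols G H)) := by
  have hadd : fromCols (A + G) (B + H) = fromCols A B + fromCols G H := by
    ext i (j | j) <;> rfl
  rw [IsFeasible, IsTLSFeasible, mul_ofComplex_eq_iff, mul_ofComplex_eq_iff, hadd, cCol_add,
    and_comm]

theorem isComplexSolution_iff_isTLSSolution (X : Matrix (Fin n) (Fin d) ℂ) :
    IsComplexSolution A B C D X ↔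
      IsTLSSolution (cCol (fromCols C D)) (cCol (fromCols A B)) X := by
  have hsurj (E : Matrix (Fin m ⊕ Fin m) (Fin n ⊕ Fin d) ℂ) :
      ∃ (G : Matrix (Fin m) (Fin n) RB) (H : Matrix (Fin m) (Fin d) RB),
        cCol (fromCols G H) = E := by
    obtain ⟨M, rfl⟩ := cCol_bijective.2 E
    exact ⟨M.toCols₁, M.toCols₂, by rw [fromCols_toCols]⟩
  simp only [IsComplexSolution, IsTLSSolution, isFeasible_iff_isTLSFeasible, rbFrob_eq_norm_cCol]
  constructor
  · rintro ⟨G, H, hfeas, hmin⟩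
    refine ⟨_, hfeas, fun X' E' h => ?_⟩
    obtain ⟨G', H', rfl⟩ := hsurj E'
    exact hmin X' G' H' h
  · rintro ⟨E, hfeas, hmin⟩
    obtain ⟨G, H, rfl⟩ := hsurj E
    exact ⟨G, H, hfeas, fun X' G' H' h => hmin X' _ h⟩

theorem rbFrob_dataJK : rbFrob (dataJK A B C D) = ‖dataJKc A B C D‖ := by
  rw [rbFrob_eq_norm_cCol, ← sq_eq_sq₀ (norm_nonneg _) (norm_nonneg _), frobenius_norm_sq,
    frobenius_norm_sq]
  simp only [Fintype.sum_sum_type, cCol, dataJK, dataJKc, fromRows_apply_inl, fromRows_apply_inr,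
    fromCols_apply_inl, fromCols_apply_inr, map_apply]
  ring

theorem dataJKc_add (ΔA : Matrix (Fin m) (Fin n) RB) (ΔB : Matrix (Fin m) (Fin d) RB)
    (ΔC : Matrix (Fin p) (Fin n) RB) (ΔD : Matrix (Fin p) (Fin d) RB) :
    dataJKc (A + ΔA) (B + ΔB) (C + ΔC) (D + ΔD) = dataJKc A B C D + dataJKc ΔA ΔB ΔC ΔD := by
  ext ((i | i) | (i | i)) (j | j) <;> rfl

theorem dataJKc_eq_fromRows :
    dataJKc A B C D = fromRows (cCol (fromCols C D)) (cCol (fromCols A B)) := by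
  ext ((i | i) | (i | i)) (j | j) <;> rfl

theorem exists_dataJKc_eq (Δ : Matrix ((Fin p ⊕ Fin p) ⊕ (Fin m ⊕ Fin m)) (Fin n ⊕ Fin d) ℂ) :
    ∃ (A : Matrix (Fin m) (Fin n) RB) (B : Matrix (Fin m) (Fin d) RB)
      (C : Matrix (Fin p) (Fin n) RB) (D : Matrix (Fin p) (Fin d) RB), dataJKc A B C D = Δ := by
  obtain ⟨CD, hCD⟩ := cCol_bijective.2 Δ.toRows₁
  obtain ⟨AB, hAB⟩ := cCol_bijective.2 Δ.toRows₂
  refine ⟨AB.toCols₁, AB.toCols₂, CD.toCols₁, CD.toCols₂, ?_⟩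
  rw [dataJKc_eq_fromRows, fromCols_toCols, fromCols_toCols, hCD, hAB, fromRows_toRows]

end Reduction

/-! ### The given factorizations form a constrained singular value decomposition -/

section Factorizations

theorem IsFullQR.orthonormal_right {p : ℕ} {α β : Type*} [Fintype α] [DecidableEq α] [Fintype β]
    [DecidableEq β] {S : Matrix (Fin p ⊕ Fin p) α ℂ} {Q₁ : Matrix α (Fin p ⊕ Fin p) ℂ}
    {Q₂ : Matrix α β ℂ} {R : Matrix (Fin p ⊕ Fin p) (Fin p ⊕ Fin p) ℂ}
    (h : IsFullQR S Q₁ Q₂ R) : Q₂ᴴ * Q₂ = 1 :=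
  (orthonormal_toCols h.left_unitary).2.2

theorem IsFullQR.mul_right_eq_zero {p : ℕ} {α β : Type*} [Fintype α] [DecidableEq α] [Fintype β]
    [DecidableEq β] {S : Matrix (Fin p ⊕ Fin p) α ℂ} {Q₁ : Matrix α (Fin p ⊕ Fin p) ℂ}
    {Q₂ : Matrix α β ℂ} {R : Matrix (Fin p ⊕ Fin p) (Fin p ⊕ Fin p) ℂ}
    (h : IsFullQR S Q₁ Q₂ R) : S * Q₂ = 0 := by
  have hS : S = Rᴴ * Q₁ᴴ := by
    rw [← conjTranspose_mul, ← conjTranspose_conjTranspose S, h.factor, fromCols_mul_fromRows,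
      Matrix.mul_zero, add_zero]
  have hQ : Q₁ᴴ * Q₂ = 0 := (orthonormal_toCols h.left_unitary).2.1
  rw [hS, Matrix.mul_assoc, hQ, Matrix.mul_zero]

variable {α β γ δ : Type*} [Fintype α] [Fintype β] [Fintype γ] [DecidableEq γ]

theorem IsMoorePenrose.mul_self_eq {M : Matrix α β ℂ} {N : Matrix β α ℂ}
    {U : Matrix α γ ℂ} {s : γ → ℝ} {V : Matrix β γ ℂ} (hN : IsMoorePenrose M N)
    (hM : IsThinSVD M U s V) : N * M = V * Vᴴ := by
  classical
  have hMV : M * (V * Vᴴ) = M := by rw [← Matrix.mul_assoc, hM.mul_right, ← hM.factor]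
  have hE : V * Vᴴ * (N * M) = N * M := by
    have h := congrArg conjTranspose (congrArg (N * ·) hMV)
    simpa only [← Matrix.mul_assoc N, conjTranspose_mul (N * M), hN.right_hermitian,
      conjTranspose_mul V, conjTranspose_conjTranspose] using h
  have hV : Vᴴ * (N * M - 1) = 0 := hM.conjTranspose_mul_eq_zero <| by
    rw [Matrix.mul_sub, ← Matrix.mul_assoc, hN.mul_mul_self, Matrix.mul_one, sub_self]
  rw [Matrix.mul_sub, Matrix.mul_one, sub_eq_zero] at hV
  rw [← hE, Matrix.mul_assoc, hV]

theorem mul_conjTranspose_add_eq_one [DecidableEq β] [Fintype δ] [DecidableEq δ]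
    {V : Matrix β γ ℂ} {W : Matrix β δ ℂ} (hV : Vᴴ * V = 1) (hW : Wᴴ * W = 1) (hVW : Vᴴ * W = 0)
    (hcard : Fintype.card β = Fintype.card γ + Fintype.card δ) : V * Vᴴ + W * Wᴴ = 1 := by
  have hWV : Wᴴ * V = 0 := by
    rw [← conjTranspose_conjTranspose V, ← conjTranspose_mul, hVW, conjTranspose_zero]
  rw [← fromCols_mul_fromRows, ← conjTranspose_fromCols_eq_fromRows_conjTranspose,
    mul_eq_one_comm_of_card_eq _ _ _ (by rw [Fintype.card_sum, hcard]),
    conjTranspose_fromCols_eq_fromRows_conjTranspose, fromRows_mul_fromCols, hV, hW, hVW, hWV,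
    fromBlocks_one]

variable [DecidableEq α] [DecidableEq β] [Fintype δ] [DecidableEq δ] {ν : Type*} [Fintype ν]
  [DecidableEq ν] {S : Matrix α (ν ⊕ δ) ℂ} {P : Matrix β (ν ⊕ δ) ℂ}
  {Q : Matrix (ν ⊕ δ) (γ ⊕ δ) ℂ} {U : Matrix β (γ ⊕ δ) ℂ} {σ₁ : γ → ℝ} {σ₂ : δ → ℝ}
  {V : Matrix (γ ⊕ δ) (γ ⊕ δ) ℂ} {Us : Matrix α α ℂ} {s : α → ℝ} {Vs : Matrix (ν ⊕ δ) α ℂ}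
  {Sd : Matrix (ν ⊕ δ) α ℂ}

/-- The decomposition obtained from an orthonormal basis `Q` of the kernel of `S`, the singular
value decompositions of `P Q` and of `S`, and the Moore-Penrose inverse of `S`. -/
def ConstrainedSVD.ofFactorizations (hQ : Qᴴ * Q = 1) (hSQ : S * Q = 0)
    (hcard : Fintype.card ν = Fintype.card α + Fintype.card γ)
    (hPQ : IsThinSVD (P * Q) U (Sum.elim σ₁ σ₂) V) (hgap : ∀ i j, σ₂ j < σ₁ i)
    (hV : IsUnit (Q * V).toBlocks₂₂) (hS : IsThinSVD S Us s Vs) (hSd : IsMoorePenrose S Sd) :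
    ConstrainedSVD S P γ :=
  have horth : (Q * V)ᴴ * (Q * V) = 1 := by
    rw [conjTranspose_mul, Matrix.mul_assoc, ← Matrix.mul_assoc Qᴴ, hQ, Matrix.one_mul,
      hPQ.right_orthonormal]
  have hcomplete : Vs * Vsᴴ + Q * V * (Q * V)ᴴ = 1 :=
    mul_conjTranspose_add_eq_one hS.right_orthonormal horth
      (by rw [← Matrix.mul_assoc, hS.conjTranspose_mul_eq_zero hSQ, Matrix.zero_mul])
      (by rw [Fintype.card_sum, Fintype.card_sum, hcard, add_assoc])
  { Us := Us, s := s, Vs := Vs, T := P * Sd, U := U, σ₁ := σ₁, σ₂ := σ₂, V := Q * V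
    svd_left := hS
    svd_right :=
      { left_orthonormal := hPQ.left_orthonormal
        right_orthonormal := horth
        pos := hPQ.pos
        factor := calc
          P - P * Sd * S = P * (1 - Vs * Vsᴴ) := by
            rw [Matrix.mul_assoc, hSd.mul_self_eq hS, Matrix.mul_sub, Matrix.mul_one]
          _ = P * (Q * V * (Q * V)ᴴ) := by rw [← hcomplete, add_sub_cancel_left]
          _ = P * Q * V * (Q * V)ᴴ := by simp only [Matrix.mul_assoc]
          _ = U * rdiag (Sum.elim σ₁ σ₂) * (Q * V)ᴴ := by rw [hPQ.mul_right] }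
    complete := hcomplete
    gap := hgap
    isUnit_det := (isUnit_iff_isUnit_det _).1 hV }

end Factorizations

/-! ### Condition numbers of complex solutions -/

section LocalSolutionMap

variable {m n d p : ℕ} {A : Matrix (Fin m) (Fin n) RB} {B : Matrix (Fin m) (Fin d) RB}
  {C : Matrix (Fin p) (Fin n) RB} {D : Matrix (Fin p) (Fin d) RB}
  {φ : Matrix ((Fin p ⊕ Fin p) ⊕ (Fin m ⊕ Fin m)) (Fin n ⊕ Fin d) ℂ → Matrix (Fin n) (Fin d) ℂ}
  {X : Matrix (Fin n) (Fin d) ℂ}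

/-- Every problem close to the given one has `φ [J_c, K_c]` as its only complex solution, where
`[J_c, K_c]` are its data in complex form. -/
def IsLocalSolutionMap (A : Matrix (Fin m) (Fin n) RB) (B : Matrix (Fin m) (Fin d) RB)
    (C : Matrix (Fin p) (Fin n) RB) (D : Matrix (Fin p) (Fin d) RB)
    (φ : Matrix ((Fin p ⊕ Fin p) ⊕ (Fin m ⊕ Fin m)) (Fin n ⊕ Fin d) ℂ →
      Matrix (Fin n) (Fin d) ℂ) : Prop :=
  ∀ᶠ ε in 𝓝[>] (0 : ℝ), ∀ ΔA ΔB ΔC ΔD, rbFrob (dataJK ΔA ΔB ΔC ΔD) ≤ ε →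
    ∀ X, IsComplexSolution (A + ΔA) (B + ΔB) (C + ΔC) (D + ΔD) X ↔
      X = φ (dataJKc A B C D + dataJKc ΔA ΔB ΔC ΔD)

theorem isLocalSolutionMap_of_eventually
    (h : ∀ᶠ N in 𝓝 (dataJKc A B C D), IsTLSSolution N.toRows₁ N.toRows₂ (φ N) ∧
      ∀ X, IsTLSSolution N.toRows₁ N.toRows₂ X → X = φ N) :
    IsLocalSolutionMap A B C D φ := by
  obtain ⟨δ, hδ, hball⟩ := Metric.eventually_nhds_iff.1 h
  filter_upwards [Ioo_mem_nhdsGT hδ] with ε hε ΔA ΔB ΔC ΔD hΔ X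
  rw [rbFrob_dataJK] at hΔ
  obtain ⟨hsol, huniq⟩ := hball (y := dataJKc A B C D + dataJKc ΔA ΔB ΔC ΔD) <| by
    rw [dist_eq_norm, add_sub_cancel_left]
    exact hΔ.trans_lt hε.2
  rw [← dataJKc_add] at hsol huniq ⊢
  rw [isComplexSolution_iff_isTLSSolution]
  rw [dataJKc_eq_fromRows] at hsol huniq ⊢
  exact ⟨huniq X, fun hX => hX ▸ hsol⟩

theorem IsLocalSolutionMap.isLocallyUniquelySolvable (h : IsLocalSolutionMap A B C D φ) :
    IsLocallyUniquelySolvable A B C D := by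
  obtain ⟨δ, hsol, hδ⟩ := (h.and self_mem_nhdsWithin).exists
  exact ⟨δ, hδ, fun ΔA ΔB ΔC ΔD hΔ => ⟨_, (hsol ΔA ΔB ΔC ΔD hΔ _).2 rfl,
    fun X => (hsol ΔA ΔB ΔC ΔD hΔ X).1⟩⟩

theorem IsLocalSolutionMap.eq_apply (h : IsLocalSolutionMap A B C D φ)
    (hX : IsComplexSolution A B C D X) : X = φ (dataJKc A B C D) := by
  obtain ⟨δ, hsol, hδ⟩ := (h.and self_mem_nhdsWithin).exists
  have hzero : dataJKc (0 : Matrix (Fin m) (Fin n) RB) (0 : Matrix (Fin m) (Fin d) RB)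
      (0 : Matrix (Fin p) (Fin n) RB) (0 : Matrix (Fin p) (Fin d) RB) = 0 := by
    ext ((i | i) | (i | i)) (j | j) <;> rfl
  have h0 := hsol 0 0 0 0 (by rw [rbFrob_dataJK, hzero, norm_zero]; exact le_of_lt hδ) X
  rw [hzero] at h0
  simp only [add_zero] at h0
  exact h0.1 hX

theorem IsLocalSolutionMap.relChangeSup_eventuallyEq (h : IsLocalSolutionMap A B C D φ)
    (hX : IsComplexSolution A B C D X) :
    relChangeSup A B C D X =ᶠ[𝓝[>] 0]
      mapRelChangeSup φ (dataJKc A B C D) ‖dataJKc A B C D‖ (frobNorm X) := by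
  obtain ⟨δ, hsol, hδ⟩ := (h.and self_mem_nhdsWithin).exists
  filter_upwards [eventually_mul_lt hδ (rbFrob (dataJK A B C D))] with ε hε
  refine le_antisymm (sSup_le ?_) (iSup₂_le fun Δ hΔ => le_sSup ?_)
  · rintro _ ⟨ΔA, ΔB, ΔC, ΔD, X', hΔ, hX', rfl⟩
    obtain rfl := (hsol ΔA ΔB ΔC ΔD (hΔ.trans hε.le) X').1 hX'
    rw [rbFrob_dataJK, rbFrob_dataJK] at hΔ
    rw [mapRelChangeSup, ← h.eq_apply hX]
    exact le_iSup₂_of_le _ hΔ le_rfl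
  · obtain ⟨ΔA, ΔB, ΔC, ΔD, rfl⟩ := exists_dataJKc_eq Δ
    rw [← rbFrob_dataJK, ← rbFrob_dataJK] at hΔ
    refine ⟨ΔA, ΔB, ΔC, ΔD, _, hΔ, (hsol ΔA ΔB ΔC ΔD (hΔ.trans hε.le) _).2 rfl, ?_⟩
    rw [← h.eq_apply hX]
    rfl

end LocalSolutionMap

theorem ConstrainedSVD.hasRelConditionNumber {m n d p q : ℕ} {A : Matrix (Fin m) (Fin n) RB}
    {B : Matrix (Fin m) (Fin d) RB} {C : Matrix (Fin p) (Fin n) RB} {D : Matrix (Fin p) (Fin d) RB}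
    (F : ConstrainedSVD (cCol (fromCols C D)) (cCol (fromCols A B)) (Fin q)) (hn : n = 2 * p + q)
    {X : Matrix (Fin n) (Fin d) ℂ} (hX : IsComplexSolution A B C D X) (hX0 : X ≠ 0) :
    HasRelConditionNumber A B C D X
      (specNorm (Hc hn F.V₂₂ (W1c F.Vs F.V₁) * Gc (Sc F.s F.σ₁) (rdiag F.σ₂) *
          Zc F.T F.Us F.U₁ F.U₂) *
        (frobNorm (dataJKc A B C D) / frobNorm X)) := by
  obtain ⟨φ, φ', hφ, hsol, hlin⟩ := F.exists_solution_map
  rw [← dataJKc_eq_fromRows] at hφ hsol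
  have hmap : IsLocalSolutionMap A B C D φ := isLocalSolutionMap_of_eventually hsol
  exact ⟨hmap.isLocallyUniquelySolvable,
    (tendsto_mapRelChangeSup hφ (F.isLeast_specNorm_Hc_mul_Gc_mul_Zc hn hlin) (norm_nonneg _)
      (norm_pos_iff.2 hX0)).congr' (hmap.relChangeSup_eventuallyEq hX).symm⟩

end RBTLSE

end

open RBTLSE

theorem theorem5p2_general {m n d p q : ℕ} (hn : n = 2 * p + q)
    (A : Matrix (Fin m) (Fin n) RB) (B : Matrix (Fin m) (Fin d) RB)
    (C : Matrix (Fin p) (Fin n) RB) (D : Matrix (Fin p) (Fin d) RB)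
    (P : Matrix (Fin m ⊕ Fin m) (Fin n ⊕ Fin d) ℂ)
    (S : Matrix (Fin p ⊕ Fin p) (Fin n ⊕ Fin d) ℂ)
    (hP : P = fromCols (cCol A) (cCol B)) (hS : S = fromCols (cCol C) (cCol D))
    (Q₂ : Matrix (Fin n ⊕ Fin d) (Fin q ⊕ Fin d) ℂ) (hQ₂ : Q₂ᴴ * Q₂ = 1) (hSQ₂ : S * Q₂ = 0)
    (U : Matrix (Fin m ⊕ Fin m) (Fin q ⊕ Fin d) ℂ) (σ₁ : Fin q → ℝ) (σ₂ : Fin d → ℝ)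
    (V : Matrix (Fin q ⊕ Fin d) (Fin q ⊕ Fin d) ℂ)
    (hSVD : IsThinSVD (P * Q₂) U (Sum.elim σ₁ σ₂) V) (hgap : ∀ i j, σ₂ j < σ₁ i)
    (V' : Matrix (Fin n ⊕ Fin d) (Fin q ⊕ Fin d) ℂ) (hV' : V' = Q₂ * V)
    (hV22 : IsUnit V'.toBlocks₂₂)
    (Us : Matrix (Fin p ⊕ Fin p) (Fin p ⊕ Fin p) ℂ) (s : Fin p ⊕ Fin p → ℝ)
    (Vs : Matrix (Fin n ⊕ Fin d) (Fin p ⊕ Fin p) ℂ) (hSs : IsThinSVD S Us s Vs)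
    (Sd : Matrix (Fin n ⊕ Fin d) (Fin p ⊕ Fin p) ℂ) (hSd : IsMoorePenrose S Sd)
    (X : Matrix (Fin n) (Fin d) ℂ) (hX : IsComplexSolution A B C D X) (hX0 : X ≠ 0) :
    HasRelConditionNumber A B C D X
      (specNorm (Hc hn V'.toBlocks₂₂ (W1c Vs V'.toCols₁) * Gc (Sc s σ₁) (rdiag σ₂) *
          Zc (P * Sd) Us U.toCols₁ U.toCols₂) *
        (frobNorm (dataJKc A B C D) / frobNorm X)) := by
  rw [← cCol_fromCols] at hP hS
  subst hP hS hV'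
  have hcard : Fintype.card (Fin n) = Fintype.card (Fin p ⊕ Fin p) + Fintype.card (Fin q) := by
    simp only [Fintype.card_sum, Fintype.card_fin]
    omega
  exact (ConstrainedSVD.ofFactorizations hQ₂ hSQ₂ hcard hSVD hgap hV22 hSs
    hSd).hasRelConditionNumber hn hX hX0

theorem theorem5p2 {m n d p q : ℕ} (hn : n = 2 * p + q) (hm : n + d ≤ m)
    -- the data of the problem
    (A : Matrix (Fin m) (Fin n) RB) (B : Matrix (Fin m) (Fin d) RB)
    (C : Matrix (Fin p) (Fin n) RB) (D : Matrix (Fin p) (Fin d) RB)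
    (hC : (cCol C).rank = 2 * p)
    (P : Matrix (Fin m ⊕ Fin m) (Fin n ⊕ Fin d) ℂ)
    (S : Matrix (Fin p ⊕ Fin p) (Fin n ⊕ Fin d) ℂ)
    (hP : P = fromCols (cCol A) (cCol B)) (hS : S = fromCols (cCol C) (cCol D))
    -- QR factorization of Sᴴ
    (Q₁ : Matrix (Fin n ⊕ Fin d) (Fin p ⊕ Fin p) ℂ) (Q₂ : Matrix (Fin n ⊕ Fin d) (Fin q ⊕ Fin d) ℂ)
    (R : Matrix (Fin p ⊕ Fin p) (Fin p ⊕ Fin p) ℂ) (hQR : IsFullQR S Q₁ Q₂ R)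
    -- thin singular value decomposition of P Q₂, with singular values (σ₁, σ₂)
    (U : Matrix (Fin m ⊕ Fin m) (Fin q ⊕ Fin d) ℂ) (σ₁ : Fin q → ℝ) (σ₂ : Fin d → ℝ)
    (V : Matrix (Fin q ⊕ Fin d) (Fin q ⊕ Fin d) ℂ)
    (hSVD : IsThinSVD (P * Q₂) U (Sum.elim σ₁ σ₂) V)
    (hσ₁ : Antitone σ₁) (hσ₂ : Antitone σ₂) (hgap : ∀ i j, σ₂ j < σ₁ i)
    (V' : Matrix (Fin n ⊕ Fin d) (Fin q ⊕ Fin d) ℂ) (hV' : V' = Q₂ * V)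
    (hV22 : IsUnit V'.toBlocks₂₂)
    -- skinny singular value decomposition and Moore-Penrose inverse of S
    (Us : Matrix (Fin p ⊕ Fin p) (Fin p ⊕ Fin p) ℂ) (s : Fin p ⊕ Fin p → ℝ)
    (Vs : Matrix (Fin n ⊕ Fin d) (Fin p ⊕ Fin p) ℂ)
    (hSs : IsThinSVD S Us s Vs) (hs : Antitone (s ∘ finSumFinEquiv.symm))
    (Sd : Matrix (Fin n ⊕ Fin d) (Fin p ⊕ Fin p) ℂ) (hSd : IsMoorePenrose S Sd)
    -- the complex solution
    (X : Matrix (Fin n) (Fin d) ℂ) (hX : IsComplexSolution A B C D X) (hX0 : X ≠ 0) :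
    HasRelConditionNumber A B C D X
      (specNorm (Hc hn V'.toBlocks₂₂ (W1c Vs V'.toCols₁) * Gc (Sc s σ₁) (rdiag σ₂) *
          Zc (P * Sd) Us U.toCols₁ U.toCols₂) *
        (frobNorm (dataJKc A B C D) / frobNorm X)) :=
  theorem5p2_general hn A B C D P S hP hS Q₂ hQR.orthonormal_right hQR.mul_right_eq_zero U σ₁ σ₂ V
    hSVD hgap V' hV' hV22 Us s Vs hSs Sd hSd X hX hX0
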